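/- Let $b\in L^\infty(0,1)$ with $\underline b:=\operatorname{ess\,inf}_{(0,1)} b>1$ and let $\tau>0$. An interior sonic-subsonic solution is a function $\rho\ge 1$ on $[0,1]$ with $\rho(0)=\rho(1)=1$ and $(\rho-1)^2\in H^1_0(0,1)$ (so that $\rho$ is taken to be its continuous representative) such that for all $\phi\in H_0^1(0,1)$ $$\int_0^1\Big[\frac{\rho+1}{2\rho^3}\big[(\rho-1)^2\big]_x+\frac{1}{\tau\rho}\Big]\phi_x\,dx+\int_0^1(\rho-b)\,\phi\,dx=0 ,$$ i.e. a weak solution of $\big((\frac1\rho-\frac1{\rho^3})\rho_x\big)_x=\rho-b-\big(\frac1{\tau\rho}\big)_x$, $\rho(0)=\rho(1)=1$. Let $\rho$ be an interior sonic-subsonic solution and put $w=\ln\rho+\frac1{2\rho^2}$. Then: (i) $\rho\in C^{1/2}[0,1]$ and $w\in C^{1,1/2}[0,1]$, and for every $1\le p<2$, $\rho\in W^{1,p}(0,1)$ and $w\in W^{2,p}(0,1)$. (ii) These regularities are optimal: $\rho\notin C^\nu[0,1]$ for every $\nu>\frac12$ (where $C^\nu=C^{k,\alpha}$, $\nu=k+\alpha$,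 $k\in\mathbb N_0$, $0<\alpha\le1$), and $\rho\notin W^{1,\kappa}(0,1)$ for every $2\le\kappa\le\infty$. (iii) For every $\tau>0$ there are constants $B_2>B_1>0$, $B_3>B_4>0$ such that for all $x<1$ near $1$, $\rho$ is differentiable at $x$ and $$B_1(1-x)^{1/2}\le\rho(x)-1\le B_2(1-x)^{1/2},\qquad -B_3(1-x)^{-1/2}\le\rho'(x)\le -B_4(1-x)^{-1/2}.$$ (iv) There is $\tau_0>0$, depending only on $\underline b$, such that for $\tau\ge\tau_0$ one has $w'(0)>0$, and the analogous singularity occurs at $x=0$: for some $B_2>B_1>0$, $B_3>B_4>0$ and all $x>0$ near $0$, $\rho$ is differentiable at $x$ and $$B_1x^{1/2}\le\rho(x)-1\le B_2x^{1/2},\qquad B_4x^{-1/2}\le\rho'(x)\le B_3x^{-1/2}.$$ On the other hand there is $\tau_1>0$, depending on $b$, such that for $0<\tau<\tau_1$ no such constants exist, i.e. $\rho$ does not have this singularity at $x=0$. -/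

import Mathlib

open MeasureTheory Set Filter Topology

/-- Lebesgue measure on the open unit interval. -/
noncomputable def unitMeasure : Measure ℝ := volume.restrict (Ioo (0 : ℝ) 1)

/-- `φ ∈ C_c^∞(0,1)` (extended by zero). -/
def IsTestFunction (φ : ℝ → ℝ) : Prop :=
  ContDiff ℝ ((⊤ : ℕ∞) : WithTop ℕ∞) φ ∧ HasCompactSupport φ ∧ tsupport φ ⊆ Ioo 0 1

/-- `g` is the weak (distributional) derivative of `f` on `(0,1)`. -/
def HasWeakDeriv (f g : ℝ → ℝ) : Prop :=
  LocallyIntegrableOn f (Ioo 0 1) volume ∧ LocallyIntegrableOn g (Ioo 0 1) volume ∧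
    ∀ φ : ℝ → ℝ, IsTestFunction φ →
      ∫ x, f x * deriv φ x ∂unitMeasure = -∫ x, g x * φ x ∂unitMeasure

/-- The Sobolev space `W^{k,p}(0,1)`, for functions on `ℝ` of which only the restriction
to `(0,1)` (up to null sets) matters. -/
def MemSobolev : ℕ → ENNReal → (ℝ → ℝ) → Prop
  | 0, p, f => MemLp f p unitMeasure
  | k + 1, p, f => MemLp f p unitMeasure ∧ ∃ g : ℝ → ℝ, HasWeakDeriv f g ∧ MemSobolev k p g

/-- The space `H_0^1(0,1)`: the closure of `C_c^∞(0,1)` in `H^1(0,1)`. -/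
def MemH10 (f : ℝ → ℝ) : Prop :=
  MemLp f 2 unitMeasure ∧ ∃ g : ℝ → ℝ, HasWeakDeriv f g ∧ MemLp g 2 unitMeasure ∧
    ∀ ε : ENNReal, 0 < ε → ∃ φ : ℝ → ℝ, IsTestFunction φ ∧
      eLpNorm (fun x => f x - φ x) 2 unitMeasure < ε ∧
      eLpNorm (fun x => g x - deriv φ x) 2 unitMeasure < ε

/-- The Hölder space `C^{k,α}[0,1]`, for functions on `ℝ` of which only the restriction to
`[0,1]` matters (derivatives at the end points are one-sided). -/
def HolderMem (k : ℕ) (α : NNReal) (f : ℝ → ℝ) : Prop :=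
  ContDiffOn ℝ k f (Icc 0 1) ∧
    ∃ C : NNReal, HolderOnWith C α (iteratedDerivWithin k f (Icc 0 1)) (Icc 0 1)

/-- The Hölder space `C^ν[0,1]` for real `ν > 0`, namely `C^{k,α}[0,1]` with `ν = k + α`,
`k ∈ ℕ` and `0 < α ≤ 1`. (For integer `ν` this is the larger space `C^{ν-1,1}`, so that
non-membership also excludes `C^ν` in the classical sense.) -/
def HolderMemReal (ν : ℝ) (f : ℝ → ℝ) : Prop :=
  ∃ (k : ℕ) (α : NNReal), 0 < α ∧ α ≤ 1 ∧ (k : ℝ) + α = ν ∧ HolderMem k α f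

/-- Interior sonic-subsonic (weak) solutions of
`((1/ρ - 1/ρ³) ρ')' = ρ - b - (1/(τρ))'`, `ρ(0) = ρ(1) = 1`.
Because `(ρ-1)²` is in `H^1(0,1)` and `ρ ≥ 1`, the function `ρ` has a unique representative that
is continuous on `[0,1]`; it is this representative that has boundary values, and `ρ` denotes it. -/
structure IsInteriorSubsonicSolution (τ : ℝ) (b ρ : ℝ → ℝ) : Prop where
  continuousOn : ContinuousOn ρ (Icc 0 1)
  one_le : ∀ x ∈ Icc (0 : ℝ) 1, 1 ≤ ρ x
  left_eq : ρ 0 = 1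
  right_eq : ρ 1 = 1
  sq_mem : MemH10 (fun x => (ρ x - 1) ^ 2)
  weak_form : ∀ g : ℝ → ℝ, HasWeakDeriv (fun x => (ρ x - 1) ^ 2) g →
    ∀ φ : ℝ → ℝ, MemH10 φ → ∀ ψ : ℝ → ℝ, HasWeakDeriv φ ψ →
      (∫ x, ((ρ x + 1) / (2 * ρ x ^ 3) * g x + 1 / (τ * ρ x)) * ψ x ∂unitMeasure)
        + ∫ x, (ρ x - b x) * φ x ∂unitMeasure = 0

/-- The transformed unknown `w = ln ρ + 1/(2ρ²)`. -/
noncomputable def transformed (ρ : ℝ → ℝ) (x : ℝ) : ℝ :=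
  Real.log (ρ x) + 1 / (2 * ρ x ^ 2)

/-- Square-root singularity at `x = 1`: near `1`, `ρ - 1` is comparable to `(1-x)^{1/2}` and
`-ρ'` exists and is comparable to `(1-x)^{-1/2}`. -/
def SqrtSingularityAtOne (ρ : ℝ → ℝ) : Prop :=
  ∃ B₁ B₂ B₃ B₄ : ℝ, 0 < B₁ ∧ B₁ < B₂ ∧ 0 < B₄ ∧ B₄ < B₃ ∧
    ∀ᶠ x in 𝓝[<] (1 : ℝ),
      B₁ * (1 - x) ^ (1 / 2 : ℝ) ≤ ρ x - 1 ∧ ρ x - 1 ≤ B₂ * (1 - x) ^ (1 / 2 : ℝ) ∧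
      DifferentiableAt ℝ ρ x ∧
      -B₃ * (1 - x) ^ (-(1 / 2) : ℝ) ≤ deriv ρ x ∧ deriv ρ x ≤ -B₄ * (1 - x) ^ (-(1 / 2) : ℝ)

/-- Square-root singularity at `x = 0`: near `0`, `ρ - 1` is comparable to `x^{1/2}` and
`ρ'` exists and is comparable to `x^{-1/2}`. -/
def SqrtSingularityAtZero (ρ : ℝ → ℝ) : Prop :=
  ∃ B₁ B₂ B₃ B₄ : ℝ, 0 < B₁ ∧ B₁ < B₂ ∧ 0 < B₄ ∧ B₄ < B₃ ∧
    ∀ᶠ x in 𝓝[>] (0 : ℝ),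
      B₁ * x ^ (1 / 2 : ℝ) ≤ ρ x - 1 ∧ ρ x - 1 ≤ B₂ * x ^ (1 / 2 : ℝ) ∧
      DifferentiableAt ℝ ρ x ∧
      B₄ * x ^ (-(1 / 2) : ℝ) ≤ deriv ρ x ∧ deriv ρ x ≤ B₃ * x ^ (-(1 / 2) : ℝ)

/-!
The idea is to trade the degenerate second order equation for `ρ` for a first order system for
`s = (ρ - 1) ^ 2` and the flux `v = w'`, where `w = ln ρ + 1 / (2 ρ ^ 2)`:
`s' = 2 ρ ^ 3 / (ρ + 1) * v` and `(v + 1 / (τ ρ))' = ρ - b`.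
The coefficient `2 ρ ^ 3 / (ρ + 1)` is bounded away from zero, and the degeneracy is confined to the
relation `ρ = 1 + √s`. Du Bois-Reymond's lemma (`HasWeakDeriv.exists_ae_eq_add_const`), applied
first to the weak form and then to `s`, shows that a weak solution solves this system classically
(`IsInteriorSubsonicSolution.exists_isClassicalSolution`); in particular `s` is `C¹` up to the
boundary, so that `ρ = 1 + √s` is `C^{1/2}`, and so is `w' = v`.

The hypothesis `b ≥ β > 1` enters through one monotonicity argument: where `ρ ≤ m < β`, the flux
strictly decreases between two points unless `ρ` increases between them (`flux_lt_flux`). Hence a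
minimum point of `ρ` over an interval to its left has negative flux (`flux_neg_of_isMinOn_left`),
while one over an interval to its right has nonnegative flux (`flux_nonneg_of_isMinOn_right`). It
follows that `ρ > 1` in `(0,1)`, that `v 1 < 0`, that `v 0 ≥ 0`, and that `v ≥ 0` near `0`.

As `s'` equals `v` where `ρ = 1`, a nonzero flux at an end point makes `s` linear to leading order
there, and `ρ - 1 = √s` has a square root singularity
(`sqrtSingularityAtZero_of_tendsto_deriv_sq`). This always happens at `1`, and it excludes all the
better regularity classes. At `0` it happens exactly if `v 0 > 0`. If `v 0 = 0`, then
`0 ≤ ρ' ≤ m ^ 3 / (2 τ)` near `0`; so in both cases `ρ'` is at most of the order of an inverse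
square root at the end points, which is in `L^p` for `p < 2`.

For large `τ` the case `v 0 = 0` cannot occur: `ρ - 1 ≤ m ^ 3 / (2 τ) x` would make `v` negative
near `0` (`flux_zero_pos`). For small `τ` the function `ρ - 1` cannot cross the line `x` downwards
(`not_sqrtSingularityAtZero`); a singularity at `0` would put `ρ - 1` above this line near `0`,
and it would stay there up to `x = 1`, where `ρ = 1`.
-/

/-! ### Weak derivatives on the unit interval -/

theorem IsTestFunction.exists_tsupport_subset {φ : ℝ → ℝ} (h : IsTestFunction φ) :
    ∃ a b, 0 < a ∧ a < b ∧ b < 1 ∧ tsupport φ ⊆ Ioo a b := by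
  obtain ⟨-, hc, hs⟩ := h
  rcases (tsupport φ).eq_empty_or_nonempty with he | hne
  · exact ⟨1 / 4, 3 / 4, by norm_num, by norm_num, by norm_num, by simp [he]⟩
  · obtain ⟨m, hm, hm'⟩ := IsCompact.exists_isLeast hc hne
    obtain ⟨M, hM, hM'⟩ := IsCompact.exists_isGreatest hc hne
    have h1 := hs hm
    have h2 := hs hM
    have h3 := hm' hM
    refine ⟨m / 2, (1 + M) / 2, by linarith [h1.1], by linarith [h1.1, h2.2], by linarith [h2.2],
      fun x hx => ⟨by linarith [hm' hx, h1.1], by linarith [hM' hx, h2.2]⟩⟩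

theorem IsTestFunction.deriv {φ : ℝ → ℝ} (h : IsTestFunction φ) : IsTestFunction (deriv φ) :=
  ⟨(contDiff_infty_iff_deriv.1 h.1).2, h.2.1.deriv,
    (tsupport_deriv_subset (𝕜 := ℝ) (f := φ)).trans h.2.2⟩

theorem integral_unitMeasure_eq {a b : ℝ} (ha : 0 < a) (hab : a < b) (hb : b < 1) {ψ : ℝ → ℝ}
    (h : ∀ x ∉ Ioo a b, ψ x = 0) : ∫ x, ψ x ∂unitMeasure = ∫ x in a..b, ψ x := by
  rw [intervalIntegral.integral_of_le hab.le, unitMeasure]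
  refine (setIntegral_eq_of_subset_of_forall_sdiff_eq_zero measurableSet_Ioo
    (fun x hx => ⟨ha.trans hx.1, hx.2.trans_lt hb⟩) fun x hx => h x fun hx' => ?_)
  exact hx.2 (Ioo_subset_Ioc_self hx')

theorem eq_zero_of_notMem_of_tsupport_subset {a b : ℝ} {φ : ℝ → ℝ} (h : tsupport φ ⊆ Ioo a b) {x : ℝ}
    (hx : x ∉ Ioo a b) : φ x = 0 :=
  image_eq_zero_of_notMem_tsupport fun h' => hx (h h')

theorem intervalIntegrable_of_locallyIntegrableOn {g : ℝ → ℝ}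
    (hg : LocallyIntegrableOn g (Ioo 0 1) volume) {a b : ℝ} (ha : a ∈ Ioo (0 : ℝ) 1)
    (hb : b ∈ Ioo (0 : ℝ) 1) : IntervalIntegrable g volume a b := by
  rw [intervalIntegrable_iff]
  exact (hg.integrableOn_compact_subset (ordConnected_Ioo.uIcc_subset ha hb)
    isCompact_uIcc).mono_set uIoc_subset_uIcc

/-- A locally absolutely continuous function has its almost everywhere derivative as weak
derivative. -/
theorem hasWeakDeriv_of_forall_sub_eq_integral {f g : ℝ → ℝ}
    (hg : LocallyIntegrableOn g (Ioo 0 1) volume)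
    (h : ∀ x ∈ Ioo (0 : ℝ) 1, ∀ y ∈ Ioo (0 : ℝ) 1, f y - f x = ∫ t in x..y, g t) :
    HasWeakDeriv f g := by
  have key : ∀ a ∈ Ioo (0 : ℝ) 1, ∀ b ∈ Ioo (0 : ℝ) 1,
      AbsolutelyContinuousOnInterval (fun x => ∫ t in a..x, g t) a b := fun a ha b hb =>
    (intervalIntegrable_of_locallyIntegrableOn hg ha
      hb).absolutelyContinuousOnInterval_intervalIntegral left_mem_uIcc
  have hcont : ContinuousOn f (Ioo 0 1) := by
    intro x hx
    obtain ⟨a, ha0, hax⟩ := exists_between hx.1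
    obtain ⟨b, hxb, hb1⟩ := exists_between hx.2
    have ha : a ∈ Ioo (0 : ℝ) 1 := ⟨ha0, hax.trans hx.2⟩
    have hb : b ∈ Ioo (0 : ℝ) 1 := ⟨hx.1.trans hxb, hb1⟩
    have h1 := (key a ha b hb).continuousOn
    rw [uIcc_of_le (hax.trans hxb).le] at h1
    have h2 : ContinuousAt (fun x => f a + ∫ t in a..x, g t) x :=
      continuousAt_const.add (h1.continuousAt (Icc_mem_nhds hax hxb))
    refine (h2.congr ?_).continuousWithinAt
    filter_upwards [Ioo_mem_nhds hx.1 hx.2] with y hy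
    rw [← h a ha y hy]; ring
  refine ⟨hcont.locallyIntegrableOn measurableSet_Ioo, hg, fun φ hφ => ?_⟩
  obtain ⟨a, b, ha, hab, hb, hs⟩ := hφ.exists_tsupport_subset
  have ha' : a ∈ Ioo (0 : ℝ) 1 := ⟨ha, hab.trans hb⟩
  have hb' : b ∈ Ioo (0 : ℝ) 1 := ⟨ha.trans hab, hb⟩
  have hs' := (tsupport_deriv_subset (𝕜 := ℝ) (f := φ)).trans hs
  rw [integral_unitMeasure_eq ha hab hb fun x hx => by
      rw [eq_zero_of_notMem_of_tsupport_subset hs' hx, mul_zero],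
    integral_unitMeasure_eq ha hab hb fun x hx => by
      rw [eq_zero_of_notMem_of_tsupport_subset hs hx, mul_zero]]
  have hac : AbsolutelyContinuousOnInterval φ a b :=
    ((hφ.1.of_le (by exact_mod_cast le_top)).contDiffOn (n := 1)).absolutelyContinuousOnInterval
  have hca : AbsolutelyContinuousOnInterval (fun _ : ℝ => f a) a b :=
    (contDiffOn_const (n := 1) (𝕜 := ℝ)).absolutelyContinuousOnInterval
  have hF := hca.add (key a ha' b hb')
  have hparts := hF.integral_mul_deriv_eq_deriv_mul hac
  rw [eq_zero_of_notMem_of_tsupport_subset hs (x := a) (by simp),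
    eq_zero_of_notMem_of_tsupport_subset hs (x := b) (by simp), mul_zero, mul_zero, sub_zero,
    zero_sub] at hparts
  have hle : uIcc a b = Icc a b := uIcc_of_le hab.le
  have e1 : ∫ x in a..b, f x * deriv φ x =
      ∫ x in a..b, ((fun _ : ℝ => f a) + fun x => ∫ t in a..x, g t) x * deriv φ x := by
    refine intervalIntegral.integral_congr fun x hx => ?_
    rw [hle] at hx
    simp only [Pi.add_apply]
    rw [← h a ha' x ⟨ha.trans_le hx.1, hx.2.trans_lt hb⟩]
    ring
  rw [e1, hparts]
  congr 1
  refine intervalIntegral.integral_congr_ae ?_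
  filter_upwards [(intervalIntegrable_of_locallyIntegrableOn hg ha'
    hb').ae_hasDerivAt_integral] with x hx hx'
  have := (hx (uIoc_subset_uIcc hx') a left_mem_uIcc).const_add (f a)
  have e2 : deriv ((fun _ : ℝ => f a) + fun x => ∫ t in a..x, g t) x = g x := this.deriv
  rw [e2]

theorem hasWeakDeriv_of_hasDerivAt {f f' : ℝ → ℝ} (hf' : ContinuousOn f' (Ioo 0 1))
    (h : ∀ x ∈ Ioo (0 : ℝ) 1, HasDerivAt f (f' x) x) : HasWeakDeriv f f' := by
  refine hasWeakDeriv_of_forall_sub_eq_integral (hf'.locallyIntegrableOn measurableSet_Ioo)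
    fun x hx y hy => ?_
  have hsub : uIcc x y ⊆ Ioo 0 1 := ordConnected_Ioo.uIcc_subset hx hy
  exact (intervalIntegral.integral_eq_sub_of_hasDerivAt (fun z hz => h z (hsub hz))
    (hf'.mono hsub).intervalIntegrable).symm

theorem IsTestFunction.hasWeakDeriv {φ : ℝ → ℝ} (h : IsTestFunction φ) :
    HasWeakDeriv φ (_root_.deriv φ) :=
  hasWeakDeriv_of_hasDerivAt h.deriv.1.continuous.continuousOn fun x _ =>
    ((contDiff_infty_iff_deriv.1 h.1).1 x).hasDerivAt

instance : IsFiniteMeasure unitMeasure := by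
  unfold unitMeasure; infer_instance

theorem IsTestFunction.memH10 {φ : ℝ → ℝ} (h : IsTestFunction φ) : MemH10 φ :=
  ⟨h.1.continuous.memLp_of_hasCompactSupport h.2.1, _root_.deriv φ, h.hasWeakDeriv,
    h.deriv.1.continuous.memLp_of_hasCompactSupport h.deriv.2.1,
    fun ε hε => ⟨φ, h, by simpa, by simpa⟩⟩

/-- Multiplying a function that is locally integrable on `(0,1)` by a test function. -/
theorem IsTestFunction.integrable_mul {f φ : ℝ → ℝ} (hφ : IsTestFunction φ)
    (hf : LocallyIntegrableOn f (Ioo 0 1) volume) :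
    Integrable (fun x => f x * φ x) unitMeasure := by
  obtain ⟨a, b, ha, hab, hb, hs⟩ := hφ.exists_tsupport_subset
  have hi : IntegrableOn (fun x => f x * φ x) (Icc a b) volume :=
    (hf.integrableOn_compact_subset (Icc_subset_Ioo ha hb) isCompact_Icc).mul_continuousOn
      hφ.1.continuous.continuousOn isCompact_Icc
  have : IntegrableOn (fun x => f x * φ x) univ volume :=
    hi.of_forall_sdiff_eq_zero MeasurableSet.univ fun x hx => by
      rw [eq_zero_of_notMem_of_tsupport_subset hs fun h' => hx.2 (Ioo_subset_Icc_self h'), mul_zero]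
  exact this.mono_set (subset_univ _)

theorem IsTestFunction.sub_const_mul {φ ψ : ℝ → ℝ} (hφ : IsTestFunction φ) (hψ : IsTestFunction ψ)
    (c : ℝ) : IsTestFunction (fun x => φ x - c * ψ x) := by
  refine ⟨hφ.1.sub (contDiff_const.mul hψ.1), hφ.2.1.sub hψ.2.1.mul_left, ?_⟩
  refine (tsupport_sub φ fun x => c * ψ x).trans (union_subset hφ.2.2 ?_)
  exact (tsupport_mul_subset_right (f := fun _ => c)).trans hψ.2.2

/-- A test function of mean zero is the derivative of a test function. -/
theorem IsTestFunction.exists_deriv_eq {φ : ℝ → ℝ} (hφ : IsTestFunction φ)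
    (h0 : ∫ x, φ x ∂unitMeasure = 0) : ∃ ψ, IsTestFunction ψ ∧ _root_.deriv ψ = φ := by
  obtain ⟨a, b, ha, hab, hb, hs⟩ := hφ.exists_tsupport_subset
  rw [integral_unitMeasure_eq ha hab hb fun x hx => eq_zero_of_notMem_of_tsupport_subset hs hx] at h0
  have hd : ∀ x, HasDerivAt (fun x => ∫ t in a..x, φ t) (φ x) x := fun x =>
    hφ.1.continuous.integral_hasStrictDerivAt a x |>.hasDerivAt
  have hderiv : _root_.deriv (fun x => ∫ t in a..x, φ t) = φ := funext fun x => (hd x).deriv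
  have hz : ∀ x ∉ Icc a b, ∫ t in a..x, φ t = 0 := by
    intro x hx
    have hii : ∀ c d, IntervalIntegrable φ volume c d := fun c d =>
      hφ.1.continuous.intervalIntegrable c d
    rcases lt_or_ge x a with hxa | hxa
    · refine intervalIntegral.integral_zero_ae (Eventually.of_forall fun t ht => ?_)
      rw [uIoc_of_ge hxa.le] at ht
      exact eq_zero_of_notMem_of_tsupport_subset hs fun h => absurd h.1 (not_lt.2 ht.2)
    · have hbx : b < x := by
        by_contra hc
        exact hx ⟨hxa, not_lt.1 hc⟩
      rw [← intervalIntegral.integral_add_adjacent_intervals (hii a b) (hii b x), h0, zero_add]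
      refine intervalIntegral.integral_zero_ae (Eventually.of_forall fun t ht => ?_)
      rw [uIoc_of_le hbx.le] at ht
      exact eq_zero_of_notMem_of_tsupport_subset hs fun h => absurd h.2 (not_lt.2 ht.1.le)
  refine ⟨fun x => ∫ t in a..x, φ t, ⟨?_, ?_, ?_⟩, hderiv⟩
  · rw [contDiff_infty_iff_deriv, hderiv]
    exact ⟨fun x => (hd x).differentiableAt, hφ.1⟩
  · exact HasCompactSupport.intro isCompact_Icc fun x hx => hz x hx
  · refine (closure_minimal (fun x hx => ?_) isClosed_Icc).trans (Icc_subset_Ioo ha hb)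
    by_contra hc
    exact hx (hz x hc)

theorem exists_isTestFunction_integral_eq_one :
    ∃ φ, IsTestFunction φ ∧ ∫ x, φ x ∂unitMeasure = 1 := by
  let f : ContDiffBump (1 / 2 : ℝ) := ⟨1 / 8, 1 / 4, by norm_num, by norm_num⟩
  have hs : tsupport (f.normed volume) ⊆ Ioo 0 1 := by
    rw [f.tsupport_normed_eq, Real.closedBall_eq_Icc]
    exact Icc_subset_Ioo (by norm_num [f]) (by norm_num [f])
  refine ⟨f.normed volume, ⟨f.contDiff_normed, f.hasCompactSupport_normed, hs⟩, ?_⟩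
  rw [unitMeasure, setIntegral_eq_integral_of_forall_compl_eq_zero
    fun x hx => eq_zero_of_notMem_of_tsupport_subset hs hx]
  exact f.integral_normed

/-- The fundamental lemma of the calculus of variations on `(0,1)`. -/
theorem ae_eq_zero_of_forall_isTestFunction {f : ℝ → ℝ}
    (hf : LocallyIntegrableOn f (Ioo 0 1) volume)
    (h : ∀ φ, IsTestFunction φ → ∫ x, f x * φ x ∂unitMeasure = 0) : f =ᵐ[unitMeasure] 0 := by
  have := isOpen_Ioo.ae_eq_zero_of_integral_contDiff_smul_eq_zero hf fun g hg hc hs => by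
    rw [← h g ⟨hg, hc, hs⟩, unitMeasure, setIntegral_eq_integral_of_forall_compl_eq_zero
      fun x hx => by rw [eq_zero_of_notMem_of_tsupport_subset hs hx, mul_zero]]
    simp [mul_comm]
  exact (ae_restrict_iff' measurableSet_Ioo).2 this

theorem HasWeakDeriv.ae_eq {f g g' : ℝ → ℝ} (h : HasWeakDeriv f g) (h' : HasWeakDeriv f g') :
    g =ᵐ[unitMeasure] g' := by
  have := ae_eq_zero_of_forall_isTestFunction (h.2.1.sub h'.2.1) fun φ hφ => by
    have e := (h.2.2 φ hφ).symm.trans (h'.2.2 φ hφ)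
    simp only [Pi.sub_apply, sub_mul]
    rw [integral_sub (hφ.integrable_mul h.2.1) (hφ.integrable_mul h'.2.1)]
    linarith
  filter_upwards [this] with x hx
  exact sub_eq_zero.1 hx

/-- Du Bois-Reymond's lemma: two functions with the same weak derivative differ by a constant. -/
theorem HasWeakDeriv.exists_ae_eq_add_const {f f' g : ℝ → ℝ} (h : HasWeakDeriv f g)
    (h' : HasWeakDeriv f' g) : ∃ c : ℝ, ∀ᵐ x ∂unitMeasure, f x = c + f' x := by
  obtain ⟨φ₀, hφ₀, h1⟩ := exists_isTestFunction_integral_eq_one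
  have hl : LocallyIntegrableOn (fun x => f x - f' x) (Ioo 0 1) volume := h.1.sub h'.1
  refine ⟨∫ x, (f x - f' x) * φ₀ x ∂unitMeasure, ?_⟩
  set c := ∫ x, (f x - f' x) * φ₀ x ∂unitMeasure with hc
  have hlc : LocallyIntegrableOn (fun _ : ℝ => c) (Ioo 0 1) volume :=
    continuousOn_const.locallyIntegrableOn measurableSet_Ioo
  have hI : ∀ φ, IsTestFunction φ → Integrable φ unitMeasure := fun φ hφ =>
    (hφ.1.continuous.integrable_of_hasCompactSupport hφ.2.1).restrict
  have := ae_eq_zero_of_forall_isTestFunction (f := fun x => f x - f' x - c) (hl.sub hlc)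
      fun φ hφ => by
    have hm := hφ.sub_const_mul hφ₀ (∫ x, φ x ∂unitMeasure)
    have hm0 : ∫ x, (φ x - (∫ x, φ x ∂unitMeasure) * φ₀ x) ∂unitMeasure = 0 := by
      rw [integral_sub (hI _ hφ) ((hI _ hφ₀).const_mul _), integral_const_mul, h1, mul_one,
        sub_self]
    obtain ⟨ψ, hψ, hψ'⟩ := hm.exists_deriv_eq hm0
    have e1 := (h.2.2 ψ hψ).trans (h'.2.2 ψ hψ).symm
    rw [hψ'] at e1
    have e2 : ∫ x, (f x - f' x) * (φ x - (∫ x, φ x ∂unitMeasure) * φ₀ x) ∂unitMeasure = 0 := by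
      simp only [sub_mul (f _)]
      rw [integral_sub (hm.integrable_mul h.1) (hm.integrable_mul h'.1), e1, sub_self]
    have e3 : ∀ x, (f x - f' x) * (φ x - (∫ x, φ x ∂unitMeasure) * φ₀ x) =
      (f x - f' x) * φ x - (∫ x, φ x ∂unitMeasure) * ((f x - f' x) * φ₀ x) := fun x => by ring
    simp only [e3] at e2
    rw [integral_sub (hφ.integrable_mul hl) ((hφ₀.integrable_mul hl).const_mul _),
      integral_const_mul, ← hc] at e2
    simp only [sub_mul _ c]
    rw [integral_sub (hφ.integrable_mul hl) ((hI _ hφ).const_mul _), integral_const_mul]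
    linarith
  filter_upwards [this] with x hx
  simp only [Pi.zero_apply] at hx
  linarith

/-! ### From weak to classical solutions -/

/-- The classical form of the boundary value problem, with the flux `v = w'` (`w = transformed ρ`)
as a second unknown. The first order system is written for `(ρ - 1) ^ 2` instead of `ρ`, because
`(ρ - 1) ^ 2` stays differentiable where `ρ = 1`; the equation `(v + 1 / (τ ρ))' = ρ - b` is
written in integrated form, because `b` is only bounded and measurable. -/
structure IsClassicalSolution (τ : ℝ) (b ρ v : ℝ → ℝ) : Prop where
  continuousOn : ContinuousOn ρ (Icc 0 1)
  one_le : ∀ x ∈ Icc (0 : ℝ) 1, 1 ≤ ρ x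
  left_eq : ρ 0 = 1
  right_eq : ρ 1 = 1
  continuousOn_flux : ContinuousOn v (Icc 0 1)
  hasDerivAt_sq : ∀ x ∈ Ioo (0 : ℝ) 1,
    HasDerivAt (fun y => (ρ y - 1) ^ 2) (2 * ρ x ^ 3 / (ρ x + 1) * v x) x
  flux_sub : ∀ x ∈ Icc (0 : ℝ) 1, ∀ y ∈ Icc (0 : ℝ) 1,
    v y - v x = (1 / ρ x - 1 / ρ y) / τ + ∫ t in x..y, (ρ t - b t)

theorem intervalIntegrable_of_memLp_top {b : ℝ → ℝ} (hb : MemLp b ⊤ unitMeasure) {x y : ℝ}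
    (hx : x ∈ Icc (0 : ℝ) 1) (hy : y ∈ Icc (0 : ℝ) 1) : IntervalIntegrable b volume x y := by
  have h : IntegrableOn b (Icc 0 1) volume :=
    (integrableOn_Icc_iff_integrableOn_Ioo).2 (hb.integrable le_top)
  rw [intervalIntegrable_iff]
  exact h.mono_set (uIoc_subset_uIcc.trans (ordConnected_Icc.uIcc_subset hx hy))

theorem intervalIntegrable_of_continuousOn_Icc {f : ℝ → ℝ} (hf : ContinuousOn f (Icc 0 1))
    {x y : ℝ} (hx : x ∈ Icc (0 : ℝ) 1) (hy : y ∈ Icc (0 : ℝ) 1) :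
    IntervalIntegrable f volume x y :=
  (hf.mono (ordConnected_Icc.uIcc_subset hx hy)).intervalIntegrable

/-- The primitive of a function integrable on `(0,1)` is continuous on `[0,1]` and has this
function as weak derivative. -/
theorem hasWeakDeriv_primitive {h : ℝ → ℝ} (hh : IntegrableOn h (Icc 0 1) volume) :
    ContinuousOn (fun x => ∫ t in (0 : ℝ)..x, h t) (Icc 0 1) ∧
      HasWeakDeriv (fun x => ∫ t in (0 : ℝ)..x, h t) h := by
  have hii : ∀ x ∈ Icc (0 : ℝ) 1, ∀ y ∈ Icc (0 : ℝ) 1, IntervalIntegrable h volume x y :=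
    fun x hx y hy => by
      rw [intervalIntegrable_iff]
      exact hh.mono_set (uIoc_subset_uIcc.trans (ordConnected_Icc.uIcc_subset hx hy))
  refine ⟨?_, hasWeakDeriv_of_forall_sub_eq_integral
    (hh.mono_set Ioo_subset_Icc_self).locallyIntegrableOn fun x hx y hy => ?_⟩
  · have := intervalIntegral.continuousOn_primitive_interval
      (μ := volume) (f := h) (a := 0) (b := 1) (by rwa [uIcc_of_le zero_le_one])
    rwa [uIcc_of_le zero_le_one] at this
  · have h0 : (0 : ℝ) ∈ Icc (0 : ℝ) 1 := by simp
    exact intervalIntegral.integral_interval_sub_left (hii _ h0 _ (Ioo_subset_Icc_self hy))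
      (hii _ h0 _ (Ioo_subset_Icc_self hx))

/-- A weak solution is a classical one. The weak form says that
`(ρ + 1) / (2 ρ ^ 3) * g + 1 / (τ ρ)`, with `g` the weak derivative of `(ρ - 1) ^ 2`, has the weak
derivative `ρ - b`; hence it is a primitive of `ρ - b`, and `g` is continuous. -/
theorem IsInteriorSubsonicSolution.exists_isClassicalSolution {τ : ℝ} {b ρ : ℝ → ℝ}
    (hb : MemLp b ⊤ unitMeasure) (h : IsInteriorSubsonicSolution τ b ρ) :
    ∃ v, IsClassicalSolution τ b ρ v ∧
      HasWeakDeriv (fun x => v x + 1 / (τ * ρ x)) (fun x => ρ x - b x) := by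
  obtain ⟨-, g, hg, -, -⟩ := h.sq_mem
  have hpos : ∀ x ∈ Icc (0 : ℝ) 1, 0 < ρ x := fun x hx => zero_lt_one.trans_le (h.one_le x hx)
  have hI : Ioo (0 : ℝ) 1 ⊆ Icc 0 1 := Ioo_subset_Icc_self
  have hinv : ContinuousOn (fun x => 1 / (τ * ρ x)) (Icc 0 1) := by
    rcases eq_or_ne τ 0 with rfl | hτ
    · simpa using continuousOn_const
    · exact continuousOn_const.div (continuousOn_const.mul h.continuousOn) fun x hx =>
        mul_ne_zero hτ (hpos x hx).ne'
  have hcoef : ContinuousOn (fun x => (ρ x + 1) / (2 * ρ x ^ 3)) (Icc 0 1) :=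
    (h.continuousOn.add continuousOn_const).div
      (continuousOn_const.mul (h.continuousOn.pow 3)) fun x hx => by
        have := hpos x hx; positivity
  have hfb : IntegrableOn (fun x => ρ x - b x) (Icc 0 1) volume :=
    (h.continuousOn.integrableOn_compact isCompact_Icc).sub
      ((integrableOn_Icc_iff_integrableOn_Ioo).2 (hb.integrable le_top))
  have hF : HasWeakDeriv (fun x => (ρ x + 1) / (2 * ρ x ^ 3) * g x + 1 / (τ * ρ x))
      (fun x => ρ x - b x) := by
    refine ⟨?_, (hfb.mono_set hI).locallyIntegrableOn, fun φ hφ => ?_⟩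
    · exact (hg.2.1.continuousOn_mul (hcoef.mono hI) isOpen_Ioo.isLocallyClosed).add
        ((hinv.mono hI).locallyIntegrableOn measurableSet_Ioo)
    · have := h.weak_form g hg φ hφ.memH10 (deriv φ) hφ.hasWeakDeriv
      linarith
  obtain ⟨hPc, hP⟩ := hasWeakDeriv_primitive hfb
  obtain ⟨c, hc⟩ := hF.exists_ae_eq_add_const hP
  set P : ℝ → ℝ := fun x => ∫ t in (0 : ℝ)..x, (ρ t - b t) with hPdef
  set v : ℝ → ℝ := fun x => c + P x - 1 / (τ * ρ x) with hv
  have hvc : ContinuousOn v (Icc 0 1) := (continuousOn_const.add hPc).sub hinv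
  have hGc : ContinuousOn (fun x => 2 * ρ x ^ 3 / (ρ x + 1) * v x) (Icc 0 1) :=
    ((continuousOn_const.mul (h.continuousOn.pow 3)).div
      (h.continuousOn.add continuousOn_const) fun x hx =>
        (add_pos (hpos x hx) one_pos).ne').mul hvc
  have hmem : ∀ᵐ x ∂unitMeasure, x ∈ Ioo (0 : ℝ) 1 := ae_restrict_mem measurableSet_Ioo
  -- The weak derivative of `(ρ - 1) ^ 2` has a continuous representative.
  have hgG : ∀ᵐ x ∂unitMeasure, g x = 2 * ρ x ^ 3 / (ρ x + 1) * v x := by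
    filter_upwards [hc, hmem] with x hx hx'
    have h0 := hpos x (hI hx')
    have e : v x = (ρ x + 1) / (2 * ρ x ^ 3) * g x := by
      simp only [hv]; linarith
    rw [e]
    field_simp
  have hG : HasWeakDeriv (fun x => (ρ x - 1) ^ 2) (fun x => 2 * ρ x ^ 3 / (ρ x + 1) * v x) := by
    refine ⟨hg.1, (hGc.mono hI).locallyIntegrableOn measurableSet_Ioo, fun φ hφ => ?_⟩
    rw [hg.2.2 φ hφ]
    congr 1
    refine integral_congr_ae ?_
    filter_upwards [hgG] with x hx
    rw [hx]
  have hQ := hasWeakDeriv_primitive (hGc.integrableOn_compact isCompact_Icc)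
  obtain ⟨k, hk⟩ := hG.exists_ae_eq_add_const hQ.2
  have hs : EqOn (fun x => (ρ x - 1) ^ 2)
      (fun x => k + ∫ t in (0 : ℝ)..x, 2 * ρ t ^ 3 / (ρ t + 1) * v t) (Ioo 0 1) :=
    Measure.eqOn_open_of_ae_eq (μ := volume) hk isOpen_Ioo
      ((h.continuousOn.sub continuousOn_const).pow 2 |>.mono hI)
      ((continuousOn_const.add hQ.1).mono hI)
  refine ⟨v, ⟨h.continuousOn, h.one_le, h.left_eq, h.right_eq, hvc, fun x hx => ?_,
    fun x hx y hy => ?_⟩, ?_⟩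
  · have hx0 : ContinuousAt (fun x => 2 * ρ x ^ 3 / (ρ x + 1) * v x) x :=
      hGc.continuousAt (Icc_mem_nhds hx.1 hx.2)
    have hd := (intervalIntegral.integral_hasDerivAt_right
      (intervalIntegrable_of_continuousOn_Icc hGc (x := 0) (by simp) (hI hx))
      ((hGc.mono hI).stronglyMeasurableAtFilter isOpen_Ioo x hx) hx0).const_add k
    exact hd.congr_of_eventuallyEq (hs.eventuallyEq_of_mem (Ioo_mem_nhds hx.1 hx.2))
  · have hii : ∀ z ∈ Icc (0 : ℝ) 1, IntervalIntegrable (fun t => ρ t - b t) volume 0 z :=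
      fun z hz => (intervalIntegrable_of_continuousOn_Icc h.continuousOn (by simp) hz).sub
        (intervalIntegrable_of_memLp_top hb (by simp) hz)
    have e : P y - P x = ∫ t in x..y, (ρ t - b t) :=
      intervalIntegral.integral_interval_sub_left (hii y hy) (hii x hx)
    have e2 : ∀ z, 1 / (τ * ρ z) = 1 / ρ z / τ := fun z => by
      rw [div_div, mul_comm]
    simp only [hv, e2, sub_div]
    linarith
  · refine ⟨?_, hP.2.1, fun φ hφ => ?_⟩
    · exact ((hvc.add hinv).mono hI).locallyIntegrableOn measurableSet_Ioo
    · rw [← hF.2.2 φ hφ]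
      refine integral_congr_ae ?_
      filter_upwards [hc] with x hx
      rw [hx]
      simp only [hv]; ring

/-! ### The sign of the flux -/

theorem ae_restrict_Icc_of_ae_unitMeasure {p : ℝ → Prop} (h : ∀ᵐ t ∂unitMeasure, p t) {x y : ℝ}
    (hx : x ∈ Icc (0 : ℝ) 1) (hy : y ∈ Icc (0 : ℝ) 1) : ∀ᵐ t ∂volume.restrict (Icc x y), p t := by
  rw [unitMeasure, Measure.restrict_congr_set Ioo_ae_eq_Icc] at h
  exact ae_mono (Measure.restrict_mono (Icc_subset_Icc hx.1 hy.2) le_rfl) h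

namespace IsClassicalSolution

variable {τ β : ℝ} {b ρ v : ℝ → ℝ}

theorem intervalIntegrable_sub (h : IsClassicalSolution τ b ρ v) (hb : MemLp b ⊤ unitMeasure)
    {x y : ℝ} (hx : x ∈ Icc (0 : ℝ) 1) (hy : y ∈ Icc (0 : ℝ) 1) :
    IntervalIntegrable (fun t => ρ t - b t) volume x y :=
  (intervalIntegrable_of_continuousOn_Icc h.continuousOn hx hy).sub
    (intervalIntegrable_of_memLp_top hb hx hy)

theorem integral_sub_le (h : IsClassicalSolution τ b ρ v) (hb : MemLp b ⊤ unitMeasure)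
    (hβ : ∀ᵐ t ∂unitMeasure, β ≤ b t) {m x y : ℝ} (hx : x ∈ Icc (0 : ℝ) 1)
    (hy : y ∈ Icc (0 : ℝ) 1) (hxy : x ≤ y) (hm : ∀ t ∈ Icc x y, ρ t ≤ m) :
    ∫ t in x..y, (ρ t - b t) ≤ (m - β) * (y - x) := by
  have e : ∫ _ in x..y, (m - β) = (m - β) * (y - x) := by
    rw [intervalIntegral.integral_const, smul_eq_mul, mul_comm]
  rw [← e]
  refine intervalIntegral.integral_mono_ae_restrict hxy (h.intervalIntegrable_sub hb hx hy)
    intervalIntegrable_const ?_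
  filter_upwards [ae_restrict_Icc_of_ae_unitMeasure hβ hx hy, ae_restrict_mem measurableSet_Icc]
    with t h1 h2
  linarith [hm t h2]

theorem le_integral_sub (h : IsClassicalSolution τ b ρ v) (hb : MemLp b ⊤ unitMeasure) {B : ℝ}
    (hB : ∀ᵐ t ∂unitMeasure, b t ≤ B) {x y : ℝ} (hx : x ∈ Icc (0 : ℝ) 1)
    (hy : y ∈ Icc (0 : ℝ) 1) (hxy : x ≤ y) :
    -B * (y - x) ≤ ∫ t in x..y, (ρ t - b t) := by
  have e : ∫ _ in x..y, (-B) = -B * (y - x) := by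
    rw [intervalIntegral.integral_const, smul_eq_mul, mul_comm]
  rw [← e]
  refine intervalIntegral.integral_mono_ae_restrict hxy intervalIntegrable_const
    (h.intervalIntegrable_sub hb hx hy) ?_
  filter_upwards [ae_restrict_Icc_of_ae_unitMeasure hB hx hy, ae_restrict_mem measurableSet_Icc]
    with t h1 h2
  linarith [h.one_le t ⟨hx.1.trans h2.1, h2.2.trans hy.2⟩]

theorem pos (h : IsClassicalSolution τ b ρ v) {x : ℝ} (hx : x ∈ Icc (0 : ℝ) 1) : 0 < ρ x :=
  zero_lt_one.trans_le (h.one_le x hx)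

theorem coeff_pos (h : IsClassicalSolution τ b ρ v) {x : ℝ} (hx : x ∈ Icc (0 : ℝ) 1) :
    0 < 2 * ρ x ^ 3 / (ρ x + 1) := by
  have := h.pos hx
  positivity

theorem continuousOn_sq (h : IsClassicalSolution τ b ρ v) :
    ContinuousOn (fun x => (ρ x - 1) ^ 2) (Icc 0 1) :=
  (h.continuousOn.sub continuousOn_const).pow 2

theorem continuousOn_deriv_sq (h : IsClassicalSolution τ b ρ v) :
    ContinuousOn (fun x => 2 * ρ x ^ 3 / (ρ x + 1) * v x) (Icc 0 1) :=
  ((continuousOn_const.mul (h.continuousOn.pow 3)).div (h.continuousOn.add continuousOn_const)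
    fun _ hx => (add_pos (h.pos hx) one_pos).ne').mul h.continuousOn_flux

theorem sq_lt_sq_of_flux_pos (h : IsClassicalSolution τ b ρ v) {x y : ℝ} (hx : 0 ≤ x)
    (hxy : x < y) (hy : y ≤ 1) (hv : ∀ t ∈ Ioo x y, 0 < v t) : (ρ x - 1) ^ 2 < (ρ y - 1) ^ 2 := by
  refine strictMonoOn_of_deriv_pos (convex_Icc x y)
    (h.continuousOn_sq.mono (Icc_subset_Icc hx hy)) (fun t ht => ?_)
    (left_mem_Icc.2 hxy.le) (right_mem_Icc.2 hxy.le) hxy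
  rw [interior_Icc] at ht
  have ht' : t ∈ Ioo (0 : ℝ) 1 := ⟨hx.trans_lt ht.1, ht.2.trans_le hy⟩
  rw [(h.hasDerivAt_sq t ht').deriv]
  exact mul_pos (h.coeff_pos (Ioo_subset_Icc_self ht')) (hv t ht)

theorem sq_lt_sq_of_flux_neg (h : IsClassicalSolution τ b ρ v) {x y : ℝ} (hx : 0 ≤ x)
    (hxy : x < y) (hy : y ≤ 1) (hv : ∀ t ∈ Ioo x y, v t < 0) : (ρ y - 1) ^ 2 < (ρ x - 1) ^ 2 := by
  refine strictAntiOn_of_deriv_neg (convex_Icc x y)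
    (h.continuousOn_sq.mono (Icc_subset_Icc hx hy)) (fun t ht => ?_)
    (left_mem_Icc.2 hxy.le) (right_mem_Icc.2 hxy.le) hxy
  rw [interior_Icc] at ht
  have ht' : t ∈ Ioo (0 : ℝ) 1 := ⟨hx.trans_lt ht.1, ht.2.trans_le hy⟩
  rw [(h.hasDerivAt_sq t ht').deriv]
  exact mul_neg_of_pos_of_neg (h.coeff_pos (Ioo_subset_Icc_self ht')) (hv t ht)

/-- Where `ρ < b`, the flux drops between two points unless `ρ` increases between them. -/
theorem flux_lt_flux (h : IsClassicalSolution τ b ρ v) (hτ : 0 < τ) (hb : MemLp b ⊤ unitMeasure)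
    (hβ : ∀ᵐ t ∂unitMeasure, β ≤ b t) {m x y : ℝ} (hmβ : m < β) (hx : 0 ≤ x) (hxy : x < y)
    (hy : y ≤ 1) (hm : ∀ t ∈ Icc x y, ρ t ≤ m) (hρ : ρ y ≤ ρ x) : v y < v x := by
  have hx' : x ∈ Icc (0 : ℝ) 1 := ⟨hx, hxy.le.trans hy⟩
  have hy' : y ∈ Icc (0 : ℝ) 1 := ⟨hx.trans hxy.le, hy⟩
  have h1 := h.flux_sub x hx' y hy'
  have h2 := h.integral_sub_le hb hβ hx' hy' hxy.le hm
  have h3 : 1 / ρ x ≤ 1 / ρ y := one_div_le_one_div_of_le (h.pos hy') hρ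
  have h4 : (1 / ρ x - 1 / ρ y) / τ ≤ 0 := div_nonpos_of_nonpos_of_nonneg (by linarith) hτ.le
  have h5 : (m - β) * (y - x) < 0 := mul_neg_of_neg_of_pos (by linarith) (by linarith)
  linarith

/-- Where `ρ < b`, a minimum point of `ρ` over an interval to its left has negative flux: otherwise
the flux is positive to the left of the point, and `ρ` increases up to its minimum. -/
theorem flux_neg_of_isMinOn_left (h : IsClassicalSolution τ b ρ v) (hτ : 0 < τ)
    (hb : MemLp b ⊤ unitMeasure) (hβ : ∀ᵐ t ∂unitMeasure, β ≤ b t) {m x y : ℝ} (hmβ : m < β)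
    (hx : 0 ≤ x) (hxy : x < y) (hy : y ≤ 1) (hm : ∀ t ∈ Icc x y, ρ t ≤ m)
    (hmin : ∀ t ∈ Icc x y, ρ y ≤ ρ t) : v y < 0 := by
  by_contra! hv
  have h1 := h.sq_lt_sq_of_flux_pos hx hxy hy fun t ht => hv.trans_lt <|
    h.flux_lt_flux hτ hb hβ hmβ (hx.trans ht.1.le) ht.2 hy
      (fun u hu => hm u ⟨ht.1.le.trans hu.1, hu.2⟩) (hmin t (Ioo_subset_Icc_self ht))
  have h2 := hmin x (left_mem_Icc.2 hxy.le)
  have h3 := h.one_le y ⟨hx.trans hxy.le, hy⟩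
  nlinarith

theorem flux_nonneg_of_isMinOn_right (h : IsClassicalSolution τ b ρ v) {x y : ℝ} (hx : 0 ≤ x)
    (hxy : x < y) (hy : y ≤ 1) (hmin : ∀ t ∈ Icc x y, ρ x ≤ ρ t) : 0 ≤ v x := by
  by_contra! hv
  have h1 : ∀ᶠ t in 𝓝[Icc 0 1] x, v t < 0 :=
    (h.continuousOn_flux x ⟨hx, hxy.le.trans hy⟩).eventually_lt_const hv
  have h2 : ∀ᶠ t in 𝓝[>] x, v t < 0 := by
    refine nhdsWithin_le_of_mem ?_ h1
    exact mem_of_superset (Ioo_mem_nhdsGT (hxy.trans_le hy)) fun t ht =>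
      ⟨hx.trans ht.1.le, ht.2.le⟩
  obtain ⟨z, hz, hz'⟩ := (mem_nhdsGT_iff_exists_Ioo_subset' hxy).1 h2
  have hlt : x < min z y := lt_min hz hxy
  have h3 := h.sq_lt_sq_of_flux_neg hx hlt ((min_le_right _ _).trans hy) fun t ht =>
    hz' ⟨ht.1, ht.2.trans_le (min_le_left _ _)⟩
  have h4 := hmin (min z y) ⟨hlt.le, min_le_right _ _⟩
  have h5 := h.one_le x ⟨hx, hxy.le.trans hy⟩
  nlinarith

theorem flux_zero_nonneg (h : IsClassicalSolution τ b ρ v) : 0 ≤ v 0 :=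
  h.flux_nonneg_of_isMinOn_right le_rfl zero_lt_one le_rfl fun t ht => by
    rw [h.left_eq]; exact h.one_le t ht

theorem exists_left_le (h : IsClassicalSolution τ b ρ v) {m y : ℝ} (hy : 0 < y) (hy1 : y ≤ 1)
    (hm : ρ y < m) : ∃ x, 0 ≤ x ∧ x < y ∧ ∀ t ∈ Icc x y, ρ t ≤ m := by
  have h1 : ∀ᶠ t in 𝓝[≤] y, ρ t ≤ m := by
    have h0 : ∀ᶠ t in 𝓝[Icc 0 1] y, ρ t < m :=
      (h.continuousOn y ⟨hy.le, hy1⟩).eventually_lt_const hm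
    refine Eventually.mono (nhdsWithin_le_of_mem ?_ h0) fun t ht => ht.le
    exact mem_of_superset (Icc_mem_nhdsLE hy) fun t ht => ⟨ht.1, ht.2.trans hy1⟩
  obtain ⟨x, hx, hx'⟩ := mem_nhdsLE_iff_exists_Icc_subset.1 h1
  refine ⟨max x 0, le_max_right _ _, max_lt hx hy, fun t ht => hx' ⟨(le_max_left _ _).trans ht.1, ht.2⟩⟩

theorem exists_right_le (h : IsClassicalSolution τ b ρ v) {m : ℝ} (hm : 1 < m) :
    ∃ η, 0 < η ∧ η < 1 ∧ ∀ t ∈ Icc 0 η, ρ t ≤ m := by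
  have h1 : ∀ᶠ t in 𝓝[≥] (0 : ℝ), ρ t ≤ m := by
    have h0 : ∀ᶠ t in 𝓝[Icc 0 1] (0 : ℝ), ρ t < m :=
      (h.continuousOn 0 (by simp)).eventually_lt_const (by rwa [h.left_eq])
    exact Eventually.mono (nhdsWithin_le_of_mem (Icc_mem_nhdsGE zero_lt_one) h0) fun t ht => ht.le
  obtain ⟨x, hx, hx'⟩ := mem_nhdsGE_iff_exists_Icc_subset.1 h1
  refine ⟨min x (1 / 2), lt_min hx (by norm_num), (min_le_right _ _).trans_lt (by norm_num),
    fun t ht => hx' ⟨ht.1, ht.2.trans (min_le_left _ _)⟩⟩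

theorem flux_neg_of_eq_one (h : IsClassicalSolution τ b ρ v) (hτ : 0 < τ)
    (hb : MemLp b ⊤ unitMeasure) (hβ : ∀ᵐ t ∂unitMeasure, β ≤ b t) (h1β : 1 < β) {y : ℝ}
    (hy : 0 < y) (hy1 : y ≤ 1) (hρ : ρ y = 1) : v y < 0 := by
  obtain ⟨m, hm1, hmβ⟩ := exists_between h1β
  obtain ⟨x, hx, hxy, hm⟩ := h.exists_left_le hy hy1 (hρ.trans_lt hm1)
  refine h.flux_neg_of_isMinOn_left hτ hb hβ hmβ hx hxy hy1 hm fun t ht => ?_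
  rw [hρ]
  exact h.one_le t ⟨hx.trans ht.1, ht.2.trans hy1⟩

theorem flux_one_neg (h : IsClassicalSolution τ b ρ v) (hτ : 0 < τ)
    (hb : MemLp b ⊤ unitMeasure) (hβ : ∀ᵐ t ∂unitMeasure, β ≤ b t) (h1β : 1 < β) : v 1 < 0 :=
  h.flux_neg_of_eq_one hτ hb hβ h1β one_pos le_rfl h.right_eq

/-- The solution is strictly subsonic in the interior. -/
theorem one_lt (h : IsClassicalSolution τ b ρ v) (hτ : 0 < τ)
    (hb : MemLp b ⊤ unitMeasure) (hβ : ∀ᵐ t ∂unitMeasure, β ≤ b t) (h1β : 1 < β) {x : ℝ}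
    (hx : x ∈ Ioo (0 : ℝ) 1) : 1 < ρ x := by
  refine (h.one_le x (Ioo_subset_Icc_self hx)).lt_of_ne fun hρ => ?_
  refine (h.flux_neg_of_eq_one hτ hb hβ h1β hx.1 hx.2.le hρ.symm).not_ge ?_
  refine h.flux_nonneg_of_isMinOn_right hx.1.le hx.2 le_rfl fun t ht => ?_
  rw [← hρ]
  exact h.one_le t ⟨hx.1.le.trans ht.1, ht.2⟩

/-- The flux is nonnegative near the left end point: points of negative flux accumulating at `0`
would enclose a minimum point of `ρ`, of negative flux by `flux_neg_of_isMinOn_left` and of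
nonnegative flux by `flux_nonneg_of_isMinOn_right`. -/
theorem eventually_flux_nonneg (h : IsClassicalSolution τ b ρ v) (hτ : 0 < τ)
    (hb : MemLp b ⊤ unitMeasure) (hβ : ∀ᵐ t ∂unitMeasure, β ≤ b t) (h1β : 1 < β) :
    ∀ᶠ x in 𝓝[>] (0 : ℝ), 0 ≤ v x := by
  obtain ⟨m, hm1, hmβ⟩ := exists_between h1β
  obtain ⟨η, hη0, hη1, hm⟩ := h.exists_right_le hm1
  by_contra hne
  have hf : ∃ᶠ x in 𝓝[>] (0 : ℝ), v x < 0 := by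
    simpa [Filter.not_eventually] using hne
  obtain ⟨x₁, hvx₁, hx₁⟩ := (hf.and_eventually (Ioo_mem_nhdsGT hη0)).exists
  have hx₁' : x₁ ∈ Ioo (0 : ℝ) 1 := ⟨hx₁.1, hx₁.2.trans hη1⟩
  have hlt : ∀ᶠ t in 𝓝[>] (0 : ℝ), ρ t < ρ x₁ := by
    have h0 : ∀ᶠ t in 𝓝[Icc 0 1] (0 : ℝ), ρ t < ρ x₁ :=
      (h.continuousOn 0 (by simp)).eventually_lt_const
        (by rw [h.left_eq]; exact h.one_lt hτ hb hβ h1β hx₁')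
    exact nhdsWithin_le_of_mem (Icc_mem_nhdsGT zero_lt_one) h0
  obtain ⟨x₃, ⟨hvx₃, hρx₃⟩, hx₃⟩ :=
    ((hf.and_eventually hlt).and_eventually (Ioo_mem_nhdsGT hx₁.1)).exists
  have hsub : Icc x₃ x₁ ⊆ Icc 0 1 := Icc_subset_Icc hx₃.1.le hx₁'.2.le
  obtain ⟨x₀, hx₀, hmin⟩ := isCompact_Icc.exists_isMinOn (nonempty_Icc.2 hx₃.2.le)
    (h.continuousOn.mono hsub)
  have hmin' : ∀ t ∈ Icc x₃ x₁, ρ x₀ ≤ ρ t := fun t ht => hmin ht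
  have hx₀₁ : x₀ < x₁ := hx₀.2.lt_of_ne fun e => by
    have := hmin' x₃ (left_mem_Icc.2 hx₃.2.le)
    rw [e] at this
    exact this.not_gt hρx₃
  have hv₀ := h.flux_nonneg_of_isMinOn_right (hx₃.1.le.trans hx₀.1) hx₀₁ hx₁'.2.le
    fun t ht => hmin' t ⟨hx₀.1.trans ht.1, ht.2⟩
  have hx₃₀ : x₃ < x₀ := hx₀.1.lt_of_ne fun e => by
    rw [← e] at hv₀
    exact hv₀.not_gt hvx₃
  refine hv₀.not_gt (h.flux_neg_of_isMinOn_left hτ hb hβ hmβ hx₃.1.le hx₃₀ (hx₀₁.le.trans hx₁'.2.le)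
    (fun t ht => hm t ⟨hx₃.1.le.trans ht.1, ?_⟩) fun t ht => hmin' t ⟨ht.1, ht.2.trans hx₀.2⟩)
  exact ht.2.trans (hx₀.2.trans hx₁.2.le)

end IsClassicalSolution

/-! ### Square root singularities at the end points -/

theorem hasDerivAt_of_hasDerivAt_sq_sub_one {f : ℝ → ℝ} {g x : ℝ}
    (hd : HasDerivAt (fun y => (f y - 1) ^ 2) g x) (hf : ∀ᶠ y in 𝓝 x, 1 ≤ f y) (hx : 1 < f x) :
    HasDerivAt f (g / (2 * (f x - 1))) x := by
  have h1 := (hd.sqrt (pow_ne_zero 2 (sub_ne_zero.2 hx.ne'))).add_const 1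
  rw [Real.sqrt_sq (sub_pos.2 hx).le] at h1
  refine h1.congr_of_eventuallyEq ?_
  filter_upwards [hf] with y hy
  rw [Real.sqrt_sq (sub_nonneg.2 hy)]
  ring

/-- If `(f - 1) ^ 2` leaves zero at the point `0` with a positive slope, then `f` has a square root
singularity there. -/
theorem sqrtSingularityAtZero_of_tendsto_deriv_sq {f g : ℝ → ℝ} {g₀ : ℝ}
    (hf : ContinuousOn f (Icc 0 1)) (h1 : ∀ x ∈ Icc (0 : ℝ) 1, 1 ≤ f x) (h0 : f 0 = 1)
    (hd : ∀ x ∈ Ioo (0 : ℝ) 1, HasDerivAt (fun y => (f y - 1) ^ 2) (g x) x)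
    (hg : Tendsto g (𝓝[>] 0) (𝓝 g₀)) (hg₀ : 0 < g₀) : SqrtSingularityAtZero f := by
  -- With `g₀ = 2 a ^ 2`, the bounds `a ^ 2 < g < 4 a ^ 2` near `0` have rational square roots in
  -- terms of `a`, which gives the four constants.
  obtain ⟨a, ha, ha2⟩ : ∃ a : ℝ, 0 < a ∧ g₀ = 2 * a ^ 2 :=
    ⟨√(g₀ / 2), Real.sqrt_pos.2 (by linarith), by rw [Real.sq_sqrt (by linarith)]; ring⟩
  have hev : ∀ᶠ x in 𝓝[>] (0 : ℝ), x < 1 ∧ a ^ 2 < g x ∧ g x < 4 * a ^ 2 := by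
    filter_upwards [Ioo_mem_nhdsGT (zero_lt_one' ℝ), hg.eventually_const_lt (u := a ^ 2) (by nlinarith),
      hg.eventually_lt_const (u := 4 * a ^ 2) (by nlinarith)] with x hx h2 h3
    exact ⟨hx.2, h2, h3⟩
  obtain ⟨η, hη, hη'⟩ := (mem_nhdsGT_iff_exists_Ioo_subset).1 hev
  refine ⟨a, 2 * a, 2 * a, a / 4, ha, by linarith, by linarith, by linarith, ?_⟩
  filter_upwards [Ioo_mem_nhdsGT hη] with x hx
  obtain ⟨hx1, hgx, hgx'⟩ := hη' hx
  have hx0 : 0 < x := hx.1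
  have hsq : ContinuousOn (fun y => (f y - 1) ^ 2) (Icc 0 x) :=
    ((hf.sub continuousOn_const).pow 2).mono (Icc_subset_Icc_right hx1.le)
  obtain ⟨c, hc, hce⟩ := exists_hasDerivAt_eq_slope (fun y => (f y - 1) ^ 2) g hx0 hsq
    fun y hy => hd y ⟨hy.1, hy.2.trans hx1⟩
  obtain ⟨-, hgc, hgc'⟩ := hη' ⟨hc.1, hc.2.trans hx.2⟩
  rw [h0, sub_self, sub_zero, zero_pow two_ne_zero, sub_zero, eq_div_iff hx0.ne'] at hce
  have hfx := h1 x ⟨hx0.le, hx1.le⟩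
  have hs : 0 < √x := Real.sqrt_pos.2 hx0
  have hss : √x ^ 2 = x := Real.sq_sqrt hx0.le
  have hlow : a * √x ≤ f x - 1 := by
    refine abs_le_of_sq_le_sq' ?_ (by linarith) |>.2
    rw [mul_pow, hss, ← hce]
    exact mul_le_mul_of_nonneg_right hgc.le hx0.le
  have hup : f x - 1 ≤ 2 * a * √x := by
    refine abs_le_of_sq_le_sq' ?_ (by positivity) |>.2
    rw [mul_pow, hss, ← hce, mul_pow]
    exact mul_le_mul_of_nonneg_right (by linarith) hx0.le
  have hpos : 0 < f x - 1 := lt_of_lt_of_le (by positivity) hlow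
  have hdf := hasDerivAt_of_hasDerivAt_sq_sub_one (hd x ⟨hx0, hx1⟩)
    (by filter_upwards [Ioo_mem_nhds hx0 hx1] with y hy using h1 y (Ioo_subset_Icc_self hy))
    (by linarith)
  rw [Real.rpow_neg hx0.le, ← Real.sqrt_eq_rpow, hdf.deriv, ← div_eq_mul_inv, ← div_eq_mul_inv]
  refine ⟨hlow, hup, hdf.differentiableAt, ?_, ?_⟩
  · rw [div_le_div_iff₀ hs (by linarith)]
    calc a / 4 * (2 * (f x - 1)) ≤ a / 4 * (2 * (2 * a * √x)) := by gcongr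
      _ = a ^ 2 * √x := by ring
      _ ≤ g x * √x := by gcongr
  · rw [div_le_div_iff₀ (by linarith) hs]
    calc g x * √x ≤ 4 * a ^ 2 * √x := by gcongr
      _ = 2 * a * (2 * (a * √x)) := by ring
      _ ≤ 2 * a * (2 * (f x - 1)) := by gcongr

theorem tendsto_one_sub_nhdsLT_one : Tendsto (fun x : ℝ => 1 - x) (𝓝[<] 1) (𝓝[>] 0) := by
  refine tendsto_nhdsWithin_iff.2 ⟨?_, ?_⟩
  · have : ContinuousAt (fun x : ℝ => 1 - x) 1 := by fun_prop
    simpa [ContinuousAt] using this.tendsto.mono_left nhdsWithin_le_nhds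
  · filter_upwards [self_mem_nhdsWithin] with x hx
    exact sub_pos.2 (mem_Iio.1 hx)

theorem tendsto_one_sub_nhdsGT_zero : Tendsto (fun x : ℝ => 1 - x) (𝓝[>] 0) (𝓝[<] 1) := by
  refine tendsto_nhdsWithin_iff.2 ⟨?_, ?_⟩
  · have : ContinuousAt (fun x : ℝ => 1 - x) 0 := by fun_prop
    simpa [ContinuousAt] using this.tendsto.mono_left nhdsWithin_le_nhds
  · filter_upwards [self_mem_nhdsWithin] with x hx
    exact sub_lt_self 1 (mem_Ioi.1 hx)

theorem sqrtSingularityAtOne_of_reflect {f : ℝ → ℝ}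
    (h : SqrtSingularityAtZero fun x => f (1 - x)) : SqrtSingularityAtOne f := by
  obtain ⟨B₁, B₂, B₃, B₄, h1, h2, h3, h4, h5⟩ := h
  refine ⟨B₁, B₂, B₃, B₄, h1, h2, h3, h4, ?_⟩
  filter_upwards [tendsto_one_sub_nhdsLT_one.eventually h5] with x ⟨ha, hb, hc, hd, he⟩
  rw [deriv_comp_const_sub] at hd he
  rw [differentiableAt_comp_const_sub] at hc
  rw [sub_sub_cancel] at *
  exact ⟨ha, hb, hc, by linarith, by linarith⟩

/-- A function that is continuous on `[0,1]` and whose derivative on `(0,1)` extends continuously to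
`[0,1]` is differentiable up to the end points. -/
theorem hasDerivWithinAt_Icc_of_continuousOn {f f' : ℝ → ℝ} (hf : ContinuousOn f (Icc 0 1))
    (hf' : ContinuousOn f' (Icc 0 1)) (h : ∀ x ∈ Ioo (0 : ℝ) 1, HasDerivAt f (f' x) x) {x : ℝ}
    (hx : x ∈ Icc (0 : ℝ) 1) : HasDerivWithinAt f (f' x) (Icc 0 1) x := by
  have hI : Ioo (0 : ℝ) 1 ⊆ Icc 0 1 := Ioo_subset_Icc_self
  have hdiff : DifferentiableOn ℝ f (Ioo 0 1) := fun y hy =>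
    (h y hy).differentiableAt.differentiableWithinAt
  have hlim : ∀ (l : Filter ℝ) (y : ℝ), y ∈ Icc (0 : ℝ) 1 → l ≤ 𝓝 y → Ioo (0 : ℝ) 1 ∈ l →
      Tendsto (deriv f) l (𝓝 (f' y)) := fun l y hy hl hm => by
    have h1 : Tendsto f' l (𝓝 (f' y)) :=
      (hf' y hy).tendsto.mono_left (le_inf hl (le_principal_iff.2 (mem_of_superset hm hI)))
    refine h1.congr' ?_
    filter_upwards [hm] with z hz
    exact (h z hz).deriv.symm
  rcases eq_or_lt_of_le hx.1 with rfl | hx0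
  · refine (hasDerivWithinAt_Ici_of_tendsto_deriv hdiff ((hf 0 hx).mono hI)
      (Ioo_mem_nhdsGT one_pos) (hlim _ _ hx nhdsWithin_le_nhds (Ioo_mem_nhdsGT one_pos))).mono
        fun y hy => hy.1
  rcases eq_or_lt_of_le hx.2 with rfl | hx1
  · refine (hasDerivWithinAt_Iic_of_tendsto_deriv hdiff ((hf 1 hx).mono hI)
      (Ioo_mem_nhdsLT one_pos) (hlim _ _ hx nhdsWithin_le_nhds (Ioo_mem_nhdsLT one_pos))).mono
        fun y hy => hy.2
  exact (h x ⟨hx0, hx1⟩).hasDerivWithinAt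

namespace IsClassicalSolution

variable {τ β : ℝ} {b ρ v : ℝ → ℝ}

theorem tendsto_deriv_sq_zero (h : IsClassicalSolution τ b ρ v) :
    Tendsto (fun x => 2 * ρ x ^ 3 / (ρ x + 1) * v x) (𝓝[>] 0) (𝓝 (v 0)) := by
  have h1 := (h.continuousOn_deriv_sq 0 (by simp)).tendsto.mono_left
    (nhdsWithin_le_of_mem (Icc_mem_nhdsGT one_pos))
  rw [h.left_eq] at h1
  convert h1 using 2
  norm_num

theorem tendsto_deriv_sq_one (h : IsClassicalSolution τ b ρ v) :
    Tendsto (fun x => 2 * ρ x ^ 3 / (ρ x + 1) * v x) (𝓝[<] 1) (𝓝 (v 1)) := by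
  have h1 := (h.continuousOn_deriv_sq 1 (by simp)).tendsto.mono_left
    (nhdsWithin_le_of_mem (Icc_mem_nhdsLT one_pos))
  rw [h.right_eq] at h1
  convert h1 using 2
  norm_num

theorem sqrtSingularityAtZero (h : IsClassicalSolution τ b ρ v) (hv : 0 < v 0) :
    SqrtSingularityAtZero ρ :=
  sqrtSingularityAtZero_of_tendsto_deriv_sq h.continuousOn h.one_le h.left_eq h.hasDerivAt_sq
    h.tendsto_deriv_sq_zero hv

theorem sqrtSingularityAtOne (h : IsClassicalSolution τ b ρ v) (hv : v 1 < 0) :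
    SqrtSingularityAtOne ρ := by
  have hmem : ∀ x ∈ Icc (0 : ℝ) 1, 1 - x ∈ Icc (0 : ℝ) 1 := fun x hx =>
    ⟨by linarith [hx.2], by linarith [hx.1]⟩
  refine sqrtSingularityAtOne_of_reflect (sqrtSingularityAtZero_of_tendsto_deriv_sq
    (f := fun x => ρ (1 - x))
    (g := fun x => -(2 * ρ (1 - x) ^ 3 / (ρ (1 - x) + 1) * v (1 - x))) (g₀ := -v 1) ?_
    (fun x hx => h.one_le _ (hmem x hx)) (by simpa using h.right_eq) (fun x hx => ?_) ?_
    (by linarith))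
  · exact h.continuousOn.comp (by fun_prop) hmem
  · exact (h.hasDerivAt_sq (1 - x)
      ⟨by linarith [hx.2], by linarith [hx.1]⟩).comp_const_sub 1 x
  · exact (h.tendsto_deriv_sq_one.comp tendsto_one_sub_nhdsGT_zero).neg

theorem hasDerivAt (h : IsClassicalSolution τ b ρ v) {x : ℝ} (hx : x ∈ Ioo (0 : ℝ) 1)
    (h1 : 1 < ρ x) :
    HasDerivAt ρ (2 * ρ x ^ 3 / (ρ x + 1) * v x / (2 * (ρ x - 1))) x :=
  hasDerivAt_of_hasDerivAt_sq_sub_one (h.hasDerivAt_sq x hx)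
    (by filter_upwards [Ioo_mem_nhds hx.1 hx.2] with y hy using
      h.one_le y (Ioo_subset_Icc_self hy)) h1

theorem continuousOn_deriv (h : IsClassicalSolution τ b ρ v)
    (h1 : ∀ x ∈ Ioo (0 : ℝ) 1, 1 < ρ x) :
    ContinuousOn (fun x => 2 * ρ x ^ 3 / (ρ x + 1) * v x / (2 * (ρ x - 1))) (Ioo 0 1) :=
  (h.continuousOn_deriv_sq.mono Ioo_subset_Icc_self).div
    (continuousOn_const.mul ((h.continuousOn.mono Ioo_subset_Icc_self).sub continuousOn_const))
    fun x hx => by have := h1 x hx; exact (by linarith : 0 < 2 * (ρ x - 1)).ne'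

theorem continuousOn_transformed (h : IsClassicalSolution τ b ρ v) :
    ContinuousOn (transformed ρ) (Icc 0 1) :=
  (h.continuousOn.log fun x hx => (h.pos hx).ne').add
    (continuousOn_const.div (continuousOn_const.mul (h.continuousOn.pow 2)) fun x hx => by
      have := h.pos hx; positivity)

theorem hasDerivAt_transformed (h : IsClassicalSolution τ b ρ v) {x : ℝ}
    (hx : x ∈ Ioo (0 : ℝ) 1) (h1 : 1 < ρ x) : HasDerivAt (transformed ρ) (v x) x := by
  have hd := h.hasDerivAt hx h1
  have h0 : 0 < ρ x := by linarith
  have hl := hd.log h0.ne'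
  have hq := (hasDerivAt_const x (1 : ℝ)).div ((hd.pow 2).const_mul 2)
    (by simp only [Pi.pow_apply]; positivity)
  refine (hl.add hq).congr_deriv ?_
  simp only [Pi.pow_apply]
  have h2 : ρ x - 1 ≠ 0 := by linarith
  field_simp
  ring

theorem hasDerivWithinAt_transformed (h : IsClassicalSolution τ b ρ v)
    (h1 : ∀ x ∈ Ioo (0 : ℝ) 1, 1 < ρ x) {x : ℝ} (hx : x ∈ Icc (0 : ℝ) 1) :
    HasDerivWithinAt (transformed ρ) (v x) (Icc 0 1) x :=
  hasDerivWithinAt_Icc_of_continuousOn h.continuousOn_transformed h.continuousOn_flux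
    (fun x hx => h.hasDerivAt_transformed hx (h1 x hx)) hx

/-- The flux `v` is the derivative of `w = transformed ρ`, at the end points in the one-sided
sense. -/
theorem derivWithin_transformed (h : IsClassicalSolution τ b ρ v)
    (h1 : ∀ x ∈ Ioo (0 : ℝ) 1, 1 < ρ x) {x : ℝ} (hx : x ∈ Icc (0 : ℝ) 1) :
    derivWithin (transformed ρ) (Icc 0 1) x = v x :=
  (h.hasDerivWithinAt_transformed h1 hx).derivWithin
    (uniqueDiffOn_Icc one_pos x hx)

/-- If the flux vanishes at the left end point, then near this point it is at most
`(ρ - 1) / τ - (β - m) x`. -/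
theorem flux_le_of_flux_zero_eq_zero (h : IsClassicalSolution τ b ρ v) (hτ : 0 < τ)
    (hb : MemLp b ⊤ unitMeasure) (hβ : ∀ᵐ t ∂unitMeasure, β ≤ b t) (hv : v 0 = 0) {m x : ℝ}
    (hx : x ∈ Icc (0 : ℝ) 1) (hm : ∀ t ∈ Icc 0 x, ρ t ≤ m) :
    v x ≤ (ρ x - 1) / τ + (m - β) * x := by
  have h0 : (0 : ℝ) ∈ Icc (0 : ℝ) 1 := by simp
  have h1 := h.flux_sub 0 h0 x hx
  have h2 := h.integral_sub_le hb hβ h0 hx hx.1 hm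
  rw [h.left_eq, hv] at h1
  have h3 : 1 / 1 - 1 / ρ x ≤ ρ x - 1 := by
    have := h.one_le x hx
    have hp := h.pos hx
    have e : ρ x - 1 - (1 / 1 - 1 / ρ x) = (ρ x - 1) ^ 2 / ρ x := by field_simp
    have : 0 ≤ (ρ x - 1) ^ 2 / ρ x := by positivity
    linarith
  have h4 : (1 / 1 - 1 / ρ x) / τ ≤ (ρ x - 1) / τ := by gcongr
  linarith

/-- If the flux vanishes at the left end point, then `ρ'` is bounded above near this point. -/
theorem deriv_le_of_flux_zero_eq_zero (h : IsClassicalSolution τ b ρ v) (hτ : 0 < τ)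
    (hb : MemLp b ⊤ unitMeasure) (hβ : ∀ᵐ t ∂unitMeasure, β ≤ b t) (hv : v 0 = 0) {m x : ℝ}
    (hx : x ∈ Ioo (0 : ℝ) 1) (hm : ∀ t ∈ Icc 0 x, ρ t ≤ m) (hmβ : m ≤ β) (h1 : 1 < ρ x) :
    2 * ρ x ^ 3 / (ρ x + 1) * v x / (2 * (ρ x - 1)) ≤ m ^ 3 / (2 * τ) := by
  have h2 := h.flux_le_of_flux_zero_eq_zero hτ hb hβ hv (Ioo_subset_Icc_self hx) hm
  have h3 : (m - β) * x ≤ 0 := mul_nonpos_of_nonpos_of_nonneg (by linarith) hx.1.le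
  have h4 : ρ x ≤ m := hm x (right_mem_Icc.2 hx.1.le)
  have h5 : 0 < ρ x - 1 := by linarith
  have h6 : 0 < m := by linarith
  calc 2 * ρ x ^ 3 / (ρ x + 1) * v x / (2 * (ρ x - 1))
      ≤ 2 * ρ x ^ 3 / (ρ x + 1) * ((ρ x - 1) / τ) / (2 * (ρ x - 1)) := by
        have := h.coeff_pos (Ioo_subset_Icc_self hx)
        gcongr
        linarith
    _ = ρ x ^ 3 / ((ρ x + 1) * τ) := by field_simp
    _ ≤ m ^ 3 / (2 * τ) := by
        gcongr
        linarith

/-- For large relaxation times the flux does not vanish at the left end point: otherwise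
`ρ - 1 ≤ m ^ 3 / (2 τ) x` near `0`, so that `v ≤ (m ^ 3 / (2 τ ^ 2) - (β - m)) x < 0` there. -/
theorem flux_zero_pos (h : IsClassicalSolution τ b ρ v) (hτ : 0 < τ)
    (hb : MemLp b ⊤ unitMeasure) (hβ : ∀ᵐ t ∂unitMeasure, β ≤ b t) {m : ℝ} (hm1 : 1 < m)
    (hmβ : m < β) (hτm : m ^ 3 < 2 * τ ^ 2 * (β - m)) : 0 < v 0 := by
  refine h.flux_zero_nonneg.lt_of_ne fun hv => ?_
  obtain ⟨η, hη0, hη1, hm⟩ := h.exists_right_le hm1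
  have hgt : ∀ x ∈ Ioo (0 : ℝ) 1, 1 < ρ x := fun x hx => h.one_lt hτ hb hβ (hm1.trans hmβ) hx
  obtain ⟨x, hvx, hx⟩ := ((h.eventually_flux_nonneg hτ hb hβ (hm1.trans hmβ)).and
    (Ioo_mem_nhdsGT hη0)).exists
  have hx1 : x < 1 := hx.2.trans hη1
  have hmx : ∀ t ∈ Icc 0 x, ρ t ≤ m := fun t ht => hm t ⟨ht.1, ht.2.trans hx.2.le⟩
  have h1 := h.flux_le_of_flux_zero_eq_zero hτ hb hβ hv.symm ⟨hx.1.le, hx1.le⟩ hmx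
  obtain ⟨c, hc, hce⟩ := exists_hasDerivAt_eq_slope ρ _ hx.1
    (h.continuousOn.mono (Icc_subset_Icc_right hx1.le))
    fun y hy => h.hasDerivAt ⟨hy.1, hy.2.trans hx1⟩ (hgt y ⟨hy.1, hy.2.trans hx1⟩)
  have hc' : c ∈ Ioo (0 : ℝ) 1 := ⟨hc.1, hc.2.trans hx1⟩
  have h2 := h.deriv_le_of_flux_zero_eq_zero hτ hb hβ hv.symm hc'
    (fun t ht => hmx t ⟨ht.1, ht.2.trans hc.2.le⟩) hmβ.le (hgt c hc')
  rw [hce, h.left_eq, sub_zero, div_le_iff₀ hx.1] at h2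
  have h3 : (ρ x - 1) / τ ≤ m ^ 3 / (2 * τ) * x / τ := by gcongr
  have h4 : m ^ 3 / (2 * τ) * x / τ < (β - m) * x := by
    rw [div_lt_iff₀ hτ, div_mul_eq_mul_div, div_lt_iff₀ (by positivity)]
    nlinarith [mul_lt_mul_of_pos_right hτm hx.1]
  nlinarith

/-- For small relaxation times there is no singularity at the left end point: it would put `ρ - 1`
above the line `x` near `0`, and the equation does not let `ρ - 1` cross this line downwards, in
contradiction to `ρ 1 = 1`. -/
theorem not_sqrtSingularityAtZero (h : IsClassicalSolution τ b ρ v) (hτ : 0 < τ)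
    (hb : MemLp b ⊤ unitMeasure) {B : ℝ} (hB : ∀ᵐ t ∂unitMeasure, b t ≤ B)
    (hτB : B + 2 < 1 / (2 * τ)) (hgt : ∀ x ∈ Ioo (0 : ℝ) 1, 1 < ρ x) :
    ¬ SqrtSingularityAtZero ρ := by
  rintro ⟨B₁, _, _, _, hB₁, -, -, -, hev⟩
  have hsq : Tendsto (fun x : ℝ => √x) (𝓝[>] 0) (𝓝 0) := by
    have := Real.continuous_sqrt.tendsto 0
    rw [Real.sqrt_zero] at this
    exact this.mono_left nhdsWithin_le_nhds
  obtain ⟨a, ⟨⟨hρa, -⟩, ha⟩, haB⟩ := ((hev.and (Ioo_mem_nhdsGT (zero_lt_one' ℝ))).and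
    (hsq.eventually_lt_const hB₁)).exists
  rw [← Real.sqrt_eq_rpow] at hρa
  have ha' : a ≤ ρ a - 1 := by
    calc a = √a * √a := (Real.mul_self_sqrt ha.1.le).symm
      _ ≤ B₁ * √a := by gcongr
      _ ≤ ρ a - 1 := hρa
  have hIco : ∀ x ∈ Ico a 1, x ∈ Ioo (0 : ℝ) 1 := fun x hx => ⟨ha.1.trans_le hx.1, hx.2⟩
  have key := image_le_of_deriv_right_lt_deriv_boundary' (f := fun x => x) (f' := fun _ => 1)
    (B := fun x => ρ x - 1)
    (B' := fun x => 2 * ρ x ^ 3 / (ρ x + 1) * v x / (2 * (ρ x - 1))) continuousOn_id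
    (fun x _ => hasDerivWithinAt_id x _) ha'
    ((h.continuousOn.mono (Icc_subset_Icc_left ha.1.le)).sub continuousOn_const)
    (fun x hx => ((h.hasDerivAt (hIco x hx) (hgt x (hIco x hx))).sub_const 1).hasDerivWithinAt)
    (fun x hx hxe => ?_) (right_mem_Icc.2 ha.2.le)
  · rw [h.right_eq] at key
    norm_num at key
  · have hx' := hIco x hx
    have hxI := Ioo_subset_Icc_self hx'
    have h0 : (0 : ℝ) ∈ Icc (0 : ℝ) 1 := by simp
    have h1 := h.flux_sub 0 h0 x hxI
    have h2 := h.le_integral_sub hb hB h0 hxI hx'.1.le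
    have h3 := h.flux_zero_nonneg
    have hρ : ρ x = 1 + x := by linarith
    have hx0 := hx'.1
    have h4 : x / (2 * τ) ≤ (1 / 1 - 1 / ρ x) / τ := by
      have e : (1 / 1 - 1 / ρ x) / τ = x / ((1 + x) * τ) := by
        rw [hρ]; field_simp; ring
      rw [e]
      gcongr
      linarith [hx'.2]
    rw [h.left_eq] at h1
    have h5 : 2 * x < v x := by
      have e : x / (2 * τ) = 1 / (2 * τ) * x := by ring
      have := mul_lt_mul_of_pos_right hτB hx0
      linarith
    have h6 : 1 ≤ 2 * ρ x ^ 3 / (ρ x + 1) := by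
      rw [le_div_iff₀ (by linarith), hρ]
      nlinarith [pow_pos hx0 2, pow_pos hx0 3]
    rw [show ρ x - 1 = x by linarith, lt_div_iff₀ (by linarith)]
    nlinarith

end IsClassicalSolution

/-! ### Hölder and Sobolev regularity -/

theorem holderOnWith_half_of_abs_sub_le {f : ℝ → ℝ} {s : Set ℝ} {C : ℝ} (hC : 0 ≤ C)
    (h : ∀ x ∈ s, ∀ y ∈ s, x ≤ y → |f y - f x| ≤ C * √(y - x)) :
    HolderOnWith C.toNNReal (1 / 2) f s := by
  have key : ∀ x ∈ s, ∀ y ∈ s, x ≤ y →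
      edist (f x) (f y) ≤ (C.toNNReal : ENNReal) * edist x y ^ ((1 / 2 : NNReal) : ℝ) := by
    intro x hx y hy hxy
    have e : dist x y = y - x := by rw [dist_comm, Real.dist_eq, abs_of_nonneg (by linarith)]
    rw [edist_dist, edist_dist, e, ENNReal.ofReal_rpow_of_nonneg (by linarith) (by positivity),
      ← ENNReal.ofReal_coe_nnreal, Real.coe_toNNReal C hC, ← ENNReal.ofReal_mul hC, dist_comm,
      Real.dist_eq]
    refine ENNReal.ofReal_le_ofReal ((h x hx y hy hxy).trans_eq ?_)
    rw [Real.sqrt_eq_rpow]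
    norm_num
  intro x hx y hy
  rcases le_total x y with hxy | hxy
  · exact key x hx y hy hxy
  · rw [edist_comm, edist_comm x]
    exact key y hy x hx hxy

theorem ContinuousOn.memLp_unitMeasure {f : ℝ → ℝ} (hf : ContinuousOn f (Icc 0 1)) (p : ENNReal) :
    MemLp f p unitMeasure := by
  obtain ⟨C, hC⟩ := isCompact_Icc.exists_bound_of_continuousOn hf
  refine MemLp.of_bound ((hf.mono Ioo_subset_Icc_self).aestronglyMeasurable measurableSet_Ioo) C ?_
  filter_upwards [ae_restrict_mem measurableSet_Ioo] with x hx
  exact hC x (Ioo_subset_Icc_self hx)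

theorem HasWeakDeriv.sub {f g f' g' : ℝ → ℝ} (hf : HasWeakDeriv f f') (hg : HasWeakDeriv g g') :
    HasWeakDeriv (fun x => f x - g x) (fun x => f' x - g' x) := by
  refine ⟨hf.1.sub hg.1, hf.2.1.sub hg.2.1, fun φ hφ => ?_⟩
  simp only [sub_mul]
  rw [integral_sub (hφ.deriv.integrable_mul hf.1) (hφ.deriv.integrable_mul hg.1),
    integral_sub (hφ.integrable_mul hf.2.1) (hφ.integrable_mul hg.2.1), hf.2.2 φ hφ, hg.2.2 φ hφ]
  ring

theorem memLp_rpow_neg_half {p : ENNReal} (hp1 : 1 ≤ p) (hp2 : p < 2) :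
    MemLp (fun x : ℝ => x ^ (-(1 / 2) : ℝ)) p unitMeasure := by
  have hp0 : p ≠ 0 := (zero_lt_one.trans_le hp1).ne'
  have hpt : p ≠ ⊤ := (hp2.trans ENNReal.ofNat_lt_top).ne
  have hr : p.toReal < 2 := by
    have := (ENNReal.toReal_lt_toReal hpt ENNReal.ofNat_ne_top).2 hp2
    simpa using this
  have hm : AEStronglyMeasurable (fun x : ℝ => x ^ (-(1 / 2) : ℝ)) unitMeasure :=
    (measurable_id.pow_const _).aestronglyMeasurable
  rw [← integrable_norm_rpow_iff hm hp0 hpt]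
  have h1 : IntegrableOn (fun x : ℝ => x ^ (-(1 / 2) * p.toReal : ℝ)) (Ioo 0 1) volume := by
    rw [← integrableOn_Ioc_iff_integrableOn_Ioo,
      ← intervalIntegrable_iff_integrableOn_Ioc_of_le zero_le_one]
    exact intervalIntegral.intervalIntegrable_rpow' (by linarith)
  refine h1.congr ?_
  filter_upwards [ae_restrict_mem measurableSet_Ioo] with x hx
  rw [Real.norm_of_nonneg (Real.rpow_nonneg hx.1.le _), ← Real.rpow_mul hx.1.le]

theorem measurePreserving_one_sub_unitMeasure :
    MeasurePreserving (fun x : ℝ => 1 - x) unitMeasure unitMeasure := by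
  have h := (Measure.measurePreserving_sub_left (volume : Measure ℝ) 1).restrict_preimage
    (s := Ioo (0 : ℝ) 1) measurableSet_Ioo
  have e : (fun x : ℝ => 1 - x) ⁻¹' Ioo 0 1 = Ioo 0 1 := by
    ext x
    simp only [mem_preimage, mem_Ioo]
    constructor <;> rintro ⟨h1, h2⟩ <;> constructor <;> linarith
  rwa [e] at h

/-- A function on `(0,1)` which blows up at most like an inverse square root at the end points is
in `L^p` for `p < 2`. -/
theorem memLp_of_abs_le_rpow_neg_half {f : ℝ → ℝ} (hf : ContinuousOn f (Ioo 0 1)) {C₀ C₁ : ℝ}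
    (h0 : ∀ᶠ x in 𝓝[>] (0 : ℝ), |f x| ≤ C₀ * x ^ (-(1 / 2) : ℝ))
    (h1 : ∀ᶠ x in 𝓝[<] (1 : ℝ), |f x| ≤ C₁ * (1 - x) ^ (-(1 / 2) : ℝ)) {p : ENNReal}
    (hp1 : 1 ≤ p) (hp2 : p < 2) : MemLp f p unitMeasure := by
  have hm := (memLp_rpow_neg_half hp1 hp2)
  have hm' := hm.comp_measurePreserving measurePreserving_one_sub_unitMeasure
  obtain ⟨a, ha, ha'⟩ := mem_nhdsGT_iff_exists_Ioo_subset.1 h0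
  obtain ⟨c, hc, hc'⟩ := mem_nhdsLT_iff_exists_Ioo_subset.1 h1
  rw [mem_Ioi] at ha
  rw [mem_Iio] at hc
  obtain ⟨M, hM⟩ := isCompact_Icc.exists_bound_of_continuousOn
    (hf.mono (show Icc (a / 2) ((1 + c) / 2) ⊆ Ioo 0 1 from
      Icc_subset_Ioo (by linarith) (by linarith)))
  refine (hm.add hm').of_le_mul (c := |C₀| + |C₁| + |M|)
    (hf.aestronglyMeasurable measurableSet_Ioo) ?_
  filter_upwards [ae_restrict_mem measurableSet_Ioo] with x hx
  have hx1 : 0 < 1 - x := by linarith [hx.2]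
  have hp : 0 ≤ x ^ (-(1 / 2) : ℝ) := Real.rpow_nonneg hx.1.le _
  have hq : 0 ≤ (1 - x) ^ (-(1 / 2) : ℝ) := Real.rpow_nonneg hx1.le _
  have hp1 : 1 ≤ x ^ (-(1 / 2) : ℝ) :=
    Real.one_le_rpow_of_pos_of_le_one_of_nonpos hx.1 hx.2.le (by norm_num)
  simp only [Pi.add_apply, Function.comp_apply]
  rw [Real.norm_of_nonneg (add_nonneg hp hq), Real.norm_eq_abs]
  have hsum : ∀ K r : ℝ, 0 ≤ r → r ≤ x ^ (-(1 / 2) : ℝ) + (1 - x) ^ (-(1 / 2) : ℝ) →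
      |K| ≤ |C₀| + |C₁| + |M| → |f x| ≤ K * r →
      |f x| ≤ (|C₀| + |C₁| + |M|) * (x ^ (-(1 / 2) : ℝ) + (1 - x) ^ (-(1 / 2) : ℝ)) := by
    intro K r hr hr' hK hfK
    refine hfK.trans ?_
    calc K * r ≤ |K| * r := by gcongr; exact le_abs_self K
      _ ≤ _ := by gcongr
  have hC₀ := abs_nonneg C₀
  have hC₁ := abs_nonneg C₁
  have hM₀ := abs_nonneg M
  rcases lt_or_ge x a with hxa | hxa
  · exact hsum C₀ _ hp (by linarith) (by linarith) (ha' ⟨hx.1, hxa⟩)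
  rcases lt_or_ge c x with hxc | hxc
  · exact hsum C₁ _ hq (by linarith) (by linarith) (hc' ⟨hxc, hx.2⟩)
  · refine hsum M 1 zero_le_one (by linarith) (by linarith) ?_
    rw [mul_one]
    exact hM x ⟨by linarith, by linarith⟩

/-- A function with a square root singularity does not approach its end value at a faster
power rate. -/
theorem SqrtSingularityAtOne.not_eventually_le {f : ℝ → ℝ} (h : SqrtSingularityAtOne f) {C α : ℝ}
    (hα : 1 / 2 < α) : ¬ ∀ᶠ x in 𝓝[<] (1 : ℝ), f x - 1 ≤ C * (1 - x) ^ α := by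
  intro hC
  obtain ⟨B₁, _, _, _, hB₁, -, -, -, hev⟩ := h
  have hlim : Tendsto (fun x : ℝ => C * (1 - x) ^ (α - 1 / 2)) (𝓝[<] 1) (𝓝 0) := by
    have h1 := ((Real.continuousAt_rpow_const 0 (α - 1 / 2) (Or.inr (by linarith))).tendsto.comp
      (tendsto_one_sub_nhdsLT_one.mono_right nhdsWithin_le_nhds)).const_mul C
    rwa [Real.zero_rpow (by linarith), mul_zero] at h1
  obtain ⟨x, ⟨⟨hx1, hx2⟩, hx3⟩, hx4⟩ := (((hev.and hC).and
    (hlim.eventually_lt_const hB₁)).and self_mem_nhdsWithin).exists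
  have h0 : 0 < 1 - x := sub_pos.2 (mem_Iio.1 hx4)
  have e : (1 - x) ^ α = (1 - x) ^ (α - 1 / 2) * (1 - x) ^ (1 / 2 : ℝ) := by
    rw [← Real.rpow_add h0]; ring_nf
  have h2 := mul_lt_mul_of_pos_right hx3 (Real.rpow_pos_of_pos h0 (1 / 2))
  rw [mul_assoc, ← e] at h2
  linarith [hx1.1]

theorem SqrtSingularityAtOne.not_holderMemReal {f : ℝ → ℝ} (h : SqrtSingularityAtOne f)
    (h1 : f 1 = 1) {ν : ℝ} (hν : 1 / 2 < ν) : ¬ HolderMemReal ν f := by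
  rintro ⟨k, α, hα, hα1, hkα, hk, C, hC⟩
  have h1m : (1 : ℝ) ∈ Icc (0 : ℝ) 1 := by simp
  rcases Nat.eq_zero_or_pos k with rfl | hk0
  · rw [Nat.cast_zero, zero_add] at hkα
    refine h.not_eventually_le (C := C) (hkα.symm ▸ hν) ?_
    filter_upwards [Ioo_mem_nhdsLT (zero_lt_one' ℝ)] with x hx
    rw [iteratedDerivWithin_zero] at hC
    have := hC.dist_le (Ioo_subset_Icc_self hx) h1m
    rw [Real.dist_eq, h1, dist_comm, Real.dist_eq, abs_of_pos (a := 1 - x) (by linarith [hx.2])]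
      at this
    exact (le_abs_self _).trans this
  · have hd : DifferentiableWithinAt ℝ f (Icc 0 1) 1 :=
      (hk.differentiableOn (by exact_mod_cast hk0.ne')) 1 h1m
    obtain ⟨K, hK⟩ := hd.isBigO_sub.bound
    refine h.not_eventually_le (C := K) (α := 1) (by norm_num) ?_
    have hle : 𝓝[<] (1 : ℝ) ≤ 𝓝[Icc 0 1] 1 := nhdsWithin_le_of_mem (Icc_mem_nhdsLT one_pos)
    filter_upwards [hle hK, self_mem_nhdsWithin] with x hx hx1
    have hx1' := mem_Iio.1 hx1
    rw [h1, Real.norm_eq_abs, Real.norm_eq_abs, abs_sub_comm x, abs_of_pos (a := 1 - x)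
      (by linarith)] at hx
    rw [Real.rpow_one]
    exact (le_abs_self _).trans hx

/-- A function with a square root singularity does not have a square integrable derivative. -/
theorem SqrtSingularityAtOne.not_memLp_deriv {f : ℝ → ℝ} (h : SqrtSingularityAtOne f) :
    ¬ MemLp (deriv f) 2 unitMeasure := by
  intro hm
  obtain ⟨_, _, _, B₄, -, -, hB₄, -, hev⟩ := h
  obtain ⟨c, hc, hc'⟩ := mem_nhdsLT_iff_exists_Ioo_subset.1 hev
  rw [mem_Iio] at hc
  have hd1 : max c 0 < 1 := max_lt hc one_pos
  have hi : IntegrableOn (fun x => deriv f x ^ 2) (Ioo (max c 0) 1) volume :=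
    IntegrableOn.mono_set (t := Ioo 0 1) ((memLp_two_iff_integrable_sq hm.1).1 hm)
      (Ioo_subset_Ioo_left (le_max_right _ _))
  have hinv : IntegrableOn (fun x : ℝ => (x - 1)⁻¹) (Ioo (max c 0) 1) volume := by
    refine (hi.const_mul (B₄ ^ 2)⁻¹).mono'
      (measurable_id.sub_const 1).inv.aestronglyMeasurable ?_
    filter_upwards [ae_restrict_mem measurableSet_Ioo] with x hx
    obtain ⟨-, -, -, -, h5⟩ := hc' ⟨(le_max_left _ _).trans_lt hx.1, hx.2⟩
    have hx1 : 0 < 1 - x := by linarith [hx.2]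
    have h6 : 0 ≤ B₄ * (1 - x) ^ (-(1 / 2) : ℝ) := by positivity
    have h7 : (B₄ * (1 - x) ^ (-(1 / 2) : ℝ)) ^ 2 ≤ deriv f x ^ 2 := by nlinarith
    have h8 : (B₄ * (1 - x) ^ (-(1 / 2) : ℝ)) ^ 2 = B₄ ^ 2 * (1 - x)⁻¹ := by
      rw [mul_pow, ← Real.rpow_natCast ((1 - x) ^ _), ← Real.rpow_mul hx1.le]
      norm_num [Real.rpow_neg_one]
    rw [h8] at h7
    rw [norm_inv, Real.norm_eq_abs, abs_sub_comm, abs_of_pos hx1,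
      le_inv_mul_iff₀ (by positivity)]
    exact h7
  rw [← integrableOn_Ioc_iff_integrableOn_Ioo,
    ← intervalIntegrable_iff_integrableOn_Ioc_of_le hd1.le, intervalIntegrable_sub_inv_iff] at hinv
  rcases hinv with h' | h'
  · exact hd1.ne h'
  · exact h' right_mem_uIcc

namespace IsClassicalSolution

variable {τ β : ℝ} {b ρ v : ℝ → ℝ}

theorem exists_abs_sub_le_sqrt (h : IsClassicalSolution τ b ρ v) :
    ∃ C, 0 ≤ C ∧ ∀ x ∈ Icc (0 : ℝ) 1, ∀ y ∈ Icc (0 : ℝ) 1, x ≤ y → |ρ y - ρ x| ≤ C * √(y - x) := by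
  obtain ⟨L, hL⟩ := isCompact_Icc.exists_bound_of_continuousOn h.continuousOn_deriv_sq
  refine ⟨√L, Real.sqrt_nonneg _, fun x hx y hy hxy => ?_⟩
  rcases hxy.eq_or_lt with rfl | hxy
  · simp
  obtain ⟨c, hc, hce⟩ := exists_hasDerivAt_eq_slope _ _ hxy
    (h.continuousOn_sq.mono (Icc_subset_Icc hx.1 hy.2))
    fun z hz => h.hasDerivAt_sq z ⟨hx.1.trans_lt hz.1, hz.2.trans_le hy.2⟩
  have hLc := hL c ⟨hx.1.trans hc.1.le, hc.2.le.trans hy.2⟩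
  have hyx : 0 < y - x := sub_pos.2 hxy
  rw [hce, norm_div, Real.norm_of_nonneg hyx.le, div_le_iff₀ hyx, Real.norm_eq_abs] at hLc
  have hL0 : 0 ≤ L := by
    by_contra! hneg
    exact (abs_nonneg _).not_gt (hLc.trans_lt (mul_neg_of_neg_of_pos hneg hyx))
  rw [← Real.sqrt_mul hL0]
  refine Real.abs_le_sqrt (le_trans ?_ hLc)
  -- `(s - t) ^ 2 ≤ |s ^ 2 - t ^ 2|` for `s, t ≥ 0`
  have h1 := h.one_le x hx
  have h2 := h.one_le y hy
  rw [show (ρ y - 1) ^ 2 - (ρ x - 1) ^ 2 = (ρ y - ρ x) * ((ρ y - 1) + (ρ x - 1)) by ring, abs_mul,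
    ← sq_abs, sq]
  refine mul_le_mul_of_nonneg_left ?_ (abs_nonneg _)
  rw [abs_of_nonneg (a := ρ y - 1 + (ρ x - 1)) (by linarith), abs_le]
  constructor <;> linarith

theorem holderMem (h : IsClassicalSolution τ b ρ v) : HolderMem 0 (1 / 2) ρ := by
  obtain ⟨C, hC, hC'⟩ := h.exists_abs_sub_le_sqrt
  refine ⟨contDiffOn_zero.2 h.continuousOn, C.toNNReal, ?_⟩
  rw [iteratedDerivWithin_zero]
  exact holderOnWith_half_of_abs_sub_le hC hC'

theorem holderMem_transformed (h : IsClassicalSolution τ b ρ v) (hτ : 0 < τ)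
    (hb : MemLp b ⊤ unitMeasure) {B : ℝ} (hβ : ∀ᵐ t ∂unitMeasure, β ≤ b t)
    (hB : ∀ᵐ t ∂unitMeasure, b t ≤ B) (hgt : ∀ x ∈ Ioo (0 : ℝ) 1, 1 < ρ x) :
    HolderMem 1 (1 / 2) (transformed ρ) := by
  have hu := uniqueDiffOn_Icc (zero_lt_one' ℝ)
  have hd : EqOn (derivWithin (transformed ρ) (Icc 0 1)) v (Icc 0 1) := fun x hx =>
    h.derivWithin_transformed hgt hx
  obtain ⟨C, hC, hC'⟩ := h.exists_abs_sub_le_sqrt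
  obtain ⟨m, hm⟩ := isCompact_Icc.exists_bound_of_continuousOn h.continuousOn
  have hM : 0 ≤ |B| + |m - β| := by positivity
  refine ⟨?_, _, holderOnWith_half_of_abs_sub_le (C := C / τ + (|B| + |m - β|)) (by positivity)
    fun x hx y hy hxy => ?_⟩
  · rw [Nat.cast_one, contDiffOn_one_iff_derivWithin hu]
    exact ⟨fun x hx => (h.hasDerivWithinAt_transformed hgt hx).differentiableWithinAt,
      h.continuousOn_flux.congr hd⟩
  · rw [iteratedDerivWithin_one, hd hx, hd hy, h.flux_sub x hx y hy, add_mul]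
    refine (abs_add_le _ _).trans (add_le_add ?_ ?_)
    · rw [abs_div, abs_of_pos hτ, div_mul_eq_mul_div]
      gcongr
      refine le_trans ?_ (hC' x hx y hy hxy)
      have hx1 := h.one_le x hx
      have hy1 := h.one_le y hy
      have hx0 := h.pos hx
      have hy0 := h.pos hy
      rw [show 1 / ρ x - 1 / ρ y = (ρ y - ρ x) / (ρ x * ρ y) by field_simp, abs_div,
        abs_of_pos (mul_pos hx0 hy0)]
      exact div_le_self (abs_nonneg _) (one_le_mul_of_one_le_of_one_le hx1 hy1)
    · have h1 := h.integral_sub_le hb hβ hx hy hxy (m := m) fun t ht =>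
        (le_abs_self _).trans (hm t ⟨hx.1.trans ht.1, ht.2.trans hy.2⟩)
      have h2 := h.le_integral_sub hb hB hx hy hxy
      have h3 : y - x ≤ √(y - x) := by
        refine Real.le_sqrt_of_sq_le ?_
        nlinarith [hx.1, hy.2]
      have h0 : 0 ≤ y - x := sub_nonneg.2 hxy
      refine le_trans (abs_le.2 ⟨?_, ?_⟩) (mul_le_mul_of_nonneg_left h3 hM)
      · nlinarith [le_abs_self B, abs_nonneg (m - β)]
      · nlinarith [le_abs_self (m - β), abs_nonneg B]

theorem hasWeakDeriv (h : IsClassicalSolution τ b ρ v) (hgt : ∀ x ∈ Ioo (0 : ℝ) 1, 1 < ρ x) :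
    HasWeakDeriv ρ (fun x => 2 * ρ x ^ 3 / (ρ x + 1) * v x / (2 * (ρ x - 1))) :=
  hasWeakDeriv_of_hasDerivAt (h.continuousOn_deriv hgt) fun x hx => h.hasDerivAt hx (hgt x hx)

/-- Near the left end point, either `v 0 > 0` and there is a square root singularity, or `v 0 = 0`
and `ρ'` is bounded. -/
theorem exists_eventually_abs_deriv_le (h : IsClassicalSolution τ b ρ v) (hτ : 0 < τ)
    (hb : MemLp b ⊤ unitMeasure) (hβ : ∀ᵐ t ∂unitMeasure, β ≤ b t) (h1β : 1 < β) :
    ∃ C, ∀ᶠ x in 𝓝[>] (0 : ℝ), |2 * ρ x ^ 3 / (ρ x + 1) * v x / (2 * (ρ x - 1))| ≤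
      C * x ^ (-(1 / 2) : ℝ) := by
  have hgt : ∀ x ∈ Ioo (0 : ℝ) 1, 1 < ρ x := fun x hx => h.one_lt hτ hb hβ h1β hx
  rcases h.flux_zero_nonneg.eq_or_lt with hv | hv
  · obtain ⟨η, hη0, hη1, hm⟩ := h.exists_right_le h1β
    refine ⟨β ^ 3 / (2 * τ), ?_⟩
    filter_upwards [h.eventually_flux_nonneg hτ hb hβ h1β, Ioo_mem_nhdsGT hη0] with x hvx hx
    have hx' : x ∈ Ioo (0 : ℝ) 1 := ⟨hx.1, hx.2.trans hη1⟩
    have h1 := h.deriv_le_of_flux_zero_eq_zero hτ hb hβ hv.symm hx'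
      (fun t ht => hm t ⟨ht.1, ht.2.trans hx.2.le⟩) le_rfl (hgt x hx')
    have h2 : 1 ≤ x ^ (-(1 / 2) : ℝ) :=
      Real.one_le_rpow_of_pos_of_le_one_of_nonpos hx'.1 hx'.2.le (by norm_num)
    have h3 := hgt x hx'
    have h4 := h.coeff_pos (Ioo_subset_Icc_self hx')
    have h5 : 0 < 2 * (ρ x - 1) := by linarith
    rw [abs_of_nonneg (by positivity)]
    refine h1.trans (le_mul_of_one_le_right (by positivity) h2)
  · obtain ⟨_, _, B₃, B₄, -, -, hB₄, -, hev⟩ := h.sqrtSingularityAtZero hv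
    refine ⟨B₃, ?_⟩
    filter_upwards [hev, Ioo_mem_nhdsGT one_pos] with x ⟨_, _, _, h4, h5⟩ hx
    rw [(h.hasDerivAt hx (hgt x hx)).deriv] at h4 h5
    have h6 : 0 ≤ B₄ * x ^ (-(1 / 2) : ℝ) := mul_nonneg hB₄.le (Real.rpow_nonneg hx.1.le _)
    rwa [abs_of_nonneg (h6.trans h4)]

theorem memLp_deriv (h : IsClassicalSolution τ b ρ v) (hτ : 0 < τ)
    (hb : MemLp b ⊤ unitMeasure) (hβ : ∀ᵐ t ∂unitMeasure, β ≤ b t) (h1β : 1 < β) {p : ENNReal}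
    (hp1 : 1 ≤ p) (hp2 : p < 2) :
    MemLp (fun x => 2 * ρ x ^ 3 / (ρ x + 1) * v x / (2 * (ρ x - 1))) p unitMeasure := by
  have hgt : ∀ x ∈ Ioo (0 : ℝ) 1, 1 < ρ x := fun x hx => h.one_lt hτ hb hβ h1β hx
  obtain ⟨C, hC⟩ := h.exists_eventually_abs_deriv_le hτ hb hβ h1β
  obtain ⟨_, _, B₃, B₄, -, -, hB₄, -, hev⟩ :=
    h.sqrtSingularityAtOne (h.flux_one_neg hτ hb hβ h1β)
  refine memLp_of_abs_le_rpow_neg_half (C₁ := B₃) (h.continuousOn_deriv hgt) hC ?_ hp1 hp2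
  filter_upwards [hev, Ioo_mem_nhdsLT one_pos] with x ⟨_, _, _, h4, h5⟩ hx
  rw [(h.hasDerivAt hx (hgt x hx)).deriv] at h4 h5
  have h6 : 0 ≤ B₄ * (1 - x) ^ (-(1 / 2) : ℝ) :=
    mul_nonneg hB₄.le (Real.rpow_nonneg (by linarith [hx.2]) _)
  rw [abs_of_nonpos (by linarith)]
  linarith

theorem memSobolev (h : IsClassicalSolution τ b ρ v) (hτ : 0 < τ)
    (hb : MemLp b ⊤ unitMeasure) (hβ : ∀ᵐ t ∂unitMeasure, β ≤ b t) (h1β : 1 < β) {p : ENNReal}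
    (hp1 : 1 ≤ p) (hp2 : p < 2) : MemSobolev 1 p ρ :=
  ⟨h.continuousOn.memLp_unitMeasure p, _,
    h.hasWeakDeriv fun _ hx => h.one_lt hτ hb hβ h1β hx, h.memLp_deriv hτ hb hβ h1β hp1 hp2⟩

theorem memSobolev_transformed (h : IsClassicalSolution τ b ρ v) (hτ : 0 < τ)
    (hb : MemLp b ⊤ unitMeasure) (hβ : ∀ᵐ t ∂unitMeasure, β ≤ b t) (h1β : 1 < β)
    (hF : HasWeakDeriv (fun x => v x + 1 / (τ * ρ x)) (fun x => ρ x - b x)) {p : ENNReal}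
    (hp1 : 1 ≤ p) (hp2 : p < 2) : MemSobolev 2 p (transformed ρ) := by
  have hI : Ioo (0 : ℝ) 1 ⊆ Icc 0 1 := Ioo_subset_Icc_self
  have hgt : ∀ x ∈ Ioo (0 : ℝ) 1, 1 < ρ x := fun x hx => h.one_lt hτ hb hβ h1β hx
  set r : ℝ → ℝ := fun x => 2 * ρ x ^ 3 / (ρ x + 1) * v x / (2 * (ρ x - 1)) with hr
  have hq : ContinuousOn (fun x => -(τ * r x) / (τ * ρ x) ^ 2) (Ioo 0 1) :=
    (continuousOn_const.mul (h.continuousOn_deriv hgt)).neg.div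
      ((continuousOn_const.mul (h.continuousOn.mono hI)).pow 2) fun x hx => by
        have := h.pos (hI hx); positivity
  have hinv : HasWeakDeriv (fun x => 1 / (τ * ρ x)) (fun x => -(τ * r x) / (τ * ρ x) ^ 2) := by
    refine hasWeakDeriv_of_hasDerivAt hq fun x hx => ?_
    simp only [one_div]
    exact ((h.hasDerivAt hx (hgt x hx)).const_mul τ).inv
      (mul_pos hτ (h.pos (hI hx))).ne'
  have hv := hF.sub hinv
  simp only [add_sub_cancel_right] at hv
  refine ⟨h.continuousOn_transformed.memLp_unitMeasure p, v, hasWeakDeriv_of_hasDerivAt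
    (h.continuousOn_flux.mono hI) fun x hx => h.hasDerivAt_transformed hx (hgt x hx),
    h.continuousOn_flux.memLp_unitMeasure p, _, hv, ?_⟩
  refine ((h.continuousOn.memLp_unitMeasure p).sub (hb.mono_exponent le_top)).sub ?_
  refine (h.memLp_deriv hτ hb hβ h1β hp1 hp2).of_le_mul (c := 1 / τ)
    (hq.aestronglyMeasurable measurableSet_Ioo) ?_
  filter_upwards [ae_restrict_mem measurableSet_Ioo] with x hx
  have h1 := hgt x hx
  have h0 := h.pos (hI hx)
  have e : -(τ * r x) / (τ * ρ x) ^ 2 = -(1 / τ * (r x / ρ x ^ 2)) := by field_simp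
  rw [e, norm_neg, norm_mul, Real.norm_of_nonneg (by positivity : 0 ≤ 1 / τ), norm_div,
    Real.norm_of_nonneg (by positivity : 0 ≤ ρ x ^ 2)]
  gcongr
  exact div_le_self (norm_nonneg _) (one_le_pow₀ h1.le)

theorem not_memSobolev (h : IsClassicalSolution τ b ρ v)
    (hgt : ∀ x ∈ Ioo (0 : ℝ) 1, 1 < ρ x) (hs : SqrtSingularityAtOne ρ) {κ : ENNReal}
    (hκ : 2 ≤ κ) : ¬ MemSobolev 1 κ ρ := by
  rintro ⟨-, g, hg, hgκ⟩
  refine hs.not_memLp_deriv ((memLp_congr_ae ?_).1 (MemLp.mono_exponent hgκ hκ))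
  filter_upwards [hg.ae_eq (h.hasWeakDeriv hgt), ae_restrict_mem measurableSet_Ioo] with x hx hx'
  rw [hx, (h.hasDerivAt hx' (hgt x hx')).deriv]

end IsClassicalSolution

/-! ### The theorem on sonic-subsonic solutions -/

theorem MeasureTheory.MemLp.exists_ae_abs_le {b : ℝ → ℝ} (hb : MemLp b ⊤ unitMeasure) :
    ∃ B, ∀ᵐ t ∂unitMeasure, |b t| ≤ B := by
  have h := hb.eLpNorm_lt_top.ne
  rw [eLpNorm_exponent_top] at h
  refine ⟨(eLpNormEssSup b unitMeasure).toReal, ?_⟩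
  filter_upwards [ae_le_eLpNormEssSup (f := b) (μ := unitMeasure)] with t ht
  rw [← Real.norm_eq_abs, ← toReal_enorm]
  exact ENNReal.toReal_mono h ht

theorem MeasureTheory.MemLp.ae_essInf_le {b : ℝ → ℝ} (hb : MemLp b ⊤ unitMeasure) :
    ∀ᵐ t ∂unitMeasure, essInf b unitMeasure ≤ b t := by
  obtain ⟨B, hB⟩ := hb.exists_ae_abs_le
  exact _root_.ae_essInf_le (isBoundedUnder_of_eventually_ge (a := -B)
    (hB.mono fun t ht => neg_le_of_abs_le ht))

theorem theorem1p1 :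
    (∀ b : ℝ → ℝ, MemLp b ⊤ unitMeasure → 1 < essInf b unitMeasure →
      ∀ τ : ℝ, 0 < τ → ∀ ρ : ℝ → ℝ, IsInteriorSubsonicSolution τ b ρ →
        -- regularity
        (HolderMem 0 (1 / 2) ρ ∧ HolderMem 1 (1 / 2) (transformed ρ) ∧
          ∀ p : ENNReal, 1 ≤ p → p < 2 →
            MemSobolev 1 p ρ ∧ MemSobolev 2 p (transformed ρ)) ∧
        -- optimality
        (∀ ν : ℝ, 1 / 2 < ν → ¬ HolderMemReal ν ρ) ∧
        (∀ κ : ENNReal, 2 ≤ κ → ¬ MemSobolev 1 κ ρ) ∧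
        -- singularity at the right end point
        SqrtSingularityAtOne ρ) ∧
    -- singularity at the left end point for large relaxation times
    (∀ β : ℝ, 1 < β → ∃ τ₀ : ℝ, 0 < τ₀ ∧
      ∀ b : ℝ → ℝ, MemLp b ⊤ unitMeasure → essInf b unitMeasure = β →
        ∀ τ : ℝ, τ₀ ≤ τ → ∀ ρ : ℝ → ℝ, IsInteriorSubsonicSolution τ b ρ →
          0 < derivWithin (transformed ρ) (Icc 0 1) 0 ∧ SqrtSingularityAtZero ρ) ∧
    -- and none for small relaxation times
    (∀ b : ℝ → ℝ, MemLp b ⊤ unitMeasure → 1 < essInf b unitMeasure →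
      ∃ τ₁ : ℝ, 0 < τ₁ ∧ ∀ τ : ℝ, 0 < τ → τ < τ₁ →
        ∀ ρ : ℝ → ℝ, IsInteriorSubsonicSolution τ b ρ → ¬ SqrtSingularityAtZero ρ) := by

  refine ⟨fun b hb h1β τ hτ ρ hρ => ?_, fun β h1β => ?_, fun b hb h1β => ?_⟩
  · have hβ := hb.ae_essInf_le
    obtain ⟨B, hB⟩ := hb.exists_ae_abs_le
    obtain ⟨v, h, hF⟩ := hρ.exists_isClassicalSolution hb
    have hgt : ∀ x ∈ Ioo (0 : ℝ) 1, 1 < ρ x := fun x hx => h.one_lt hτ hb hβ h1β hx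
    have hs := h.sqrtSingularityAtOne (h.flux_one_neg hτ hb hβ h1β)
    exact ⟨⟨h.holderMem, h.holderMem_transformed hτ hb hβ (hB.mono fun t => le_of_abs_le) hgt,
      fun p hp1 hp2 => ⟨h.memSobolev hτ hb hβ h1β hp1 hp2,
        h.memSobolev_transformed hτ hb hβ h1β hF hp1 hp2⟩⟩,
      fun ν hν => hs.not_holderMemReal h.right_eq hν,
      fun κ hκ => h.not_memSobolev hgt hs hκ, hs⟩
  · obtain ⟨m, hm1, hmβ⟩ := exists_between h1β
    have hm0 : 0 < m ^ 3 := pow_pos (by linarith) 3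
    have hβm : 0 < β - m := sub_pos.2 hmβ
    -- `τ ≥ 1 + m ^ 3 / (β - m)` implies `τ ^ 2 ≥ τ > m ^ 3 / (β - m)`.
    refine ⟨1 + m ^ 3 / (β - m), by positivity, fun b hb hbβ τ hτ₀ ρ hρ => ?_⟩
    have hβ := hb.ae_essInf_le
    rw [hbβ] at hβ
    have hq : 0 < m ^ 3 / (β - m) := by positivity
    have hτ : 0 < τ := by linarith
    have hτm : m ^ 3 < 2 * τ ^ 2 * (β - m) := by
      rw [← div_lt_iff₀ hβm]
      nlinarith
    obtain ⟨v, h, -⟩ := hρ.exists_isClassicalSolution hb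
    have hv := h.flux_zero_pos hτ hb hβ hm1 hmβ hτm
    rw [h.derivWithin_transformed (fun x hx => h.one_lt hτ hb hβ h1β hx) (by simp)]
    exact ⟨hv, h.sqrtSingularityAtZero hv⟩
  · obtain ⟨B, hB⟩ := hb.exists_ae_abs_le
    have hB0 : 0 < |B| + 2 := by positivity
    refine ⟨1 / (2 * (|B| + 2)), by positivity, fun τ hτ hττ ρ hρ => ?_⟩
    obtain ⟨v, h, -⟩ := hρ.exists_isClassicalSolution hb
    refine h.not_sqrtSingularityAtZero (B := |B|) hτ hb
      (hB.mono fun t ht => (le_of_abs_le ht).trans (le_abs_self B)) ?_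
      fun x hx => h.one_lt hτ hb hb.ae_essInf_le h1β hx
    rw [lt_div_iff₀ (by positivity)] at hττ ⊢
    linarith
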